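/- Let $F=\mathbb R$ or $F=\mathbb C$, let $p,q$ be relatively prime positive integers, $k=p/q$, and let $\alpha,\beta,\omega\in F$. Consider the phase space with polar coordinates $r,\theta$ and conjugate momenta $p_r,p_\theta$ in $F$, over the domain $D=\{(r,\theta): r\neq 0,\ \sin k\theta\neq 0,\ \cos k\theta\ne 0\}$, with the Poisson bracket $$\{A,B\}=\frac{\partial A}{\partial p_r}\frac{\partial B}{\partial r}-\frac{\partial A}{\partial r}\frac{\partial B}{\partial p_r}+\frac{\partial A}{\partial p_\theta}\frac{\partial B}{\partial \theta}-\frac{\partial A}{\partial \theta}\frac{\partial B}{\partial p_\theta}.$$ A constant of the motion of $\mathcal H$ is a function $A$, analytic on the phase space over $D$, with $\{\mathcal H,A\}=0$. "Polynomial in the momenta" means that the coefficients are functions of $(r,\theta)$ analytic on $D$; the order is the degree in the momenta. Functions are called functionally independent if their Jacobian matrix has full rank on an open dense subset of the phase space over $D$. The symmetry algebra generated by a set of functions consists of all finite combinations of scalar multiples, sums, products and Poisson brackets of them. The classical TTW Hamiltonian and its second order constant of the motion are $$\mathcal H=p_r^2+\frac{p_\theta^2}{r^2}+\omega^2r^2+\frac1{r^2}\Big(\frac{\alpha}{\cos^2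 k\theta}+\frac{\beta}{\sin^2k\theta}\Big),\qquad \mathcal L_2=p_\theta^2+\frac{\alpha}{\cos^2k\theta}+\frac{\beta}{\sin^2k\theta}.$$ Put $$X=\sqrt{\mathcal L_2}\,\sin(2k\theta)\,p_\theta+i\big(-\beta+\alpha-\mathcal L_2\cos 2k\theta\big),\qquad Y=2\sqrt{\mathcal L_2}\,\frac{p_r}{r}+i\Big(\frac{2\mathcal L_2}{r^2}-\mathcal H\Big),$$ let $\overline X,\overline Y$ be obtained from $X,Y$ by replacing the explicit $i$ by $-i$, and let $\mathcal L^+=X^qY^p$, $\mathcal L^-=\overline X^{\,q}\,\overline Y^{\,p}$. Then $\mathcal L^+\mathcal L^-=P(\mathcal L_2,\mathcal H)$, where $$P(l,h)=\big((l-\alpha-\beta)^2-4\alpha\beta\big)^q\,(h^2-4\omega^2l)^p .$$ 1. There are functions $\mathcal L_3,\mathcal L_4$ that are given, wherever $\mathcal L_2\ne0$ and for either choice of $\sqrt{\mathcal L_2}\in\mathbb C$, by $$\mathcal L_3=\mathcal L^++\mathcal L^-,\quad \mathcal L_4=\frac{\mathcal L^--\mathcal L^+}{i\sqrt{\mathcal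 L_2}}\quad (p+q\text{ even}),\qquad \mathcal L_3=\frac{\mathcal L^+-\mathcal L^-}{i},\quad \mathcal L_4=\frac{\mathcal L^++\mathcal L^-}{\sqrt{\mathcal L_2}}\quad (p+q\text{ odd}).$$ They are $F$-valued constants of the motion, polynomial in the momenta, of orders $2(p+q)$ and $2(p+q)-1$. Also $\mathcal H$ and $\mathcal L_2$ are constants of the motion of order $2$. The functions $\mathcal H,\mathcal L_2,\mathcal L_3$ are functionally independent, and so are $\mathcal H,\mathcal L_2,\mathcal L_4$. Hence the system is maximally (polynomially) superintegrable: it has $3=2\cdot 2-1$ functionally independent constants of the motion that are polynomial in the momenta. 2. With $\mathcal R=\{\mathcal L_2,\mathcal L_4\}$, again a constant of the motion polynomial in the momenta, the structure equations $$\mathcal R=-4p\,\mathcal L_3,\qquad \{\mathcal L_2,\mathcal L_3\}=4p\,\mathcal L_2\mathcal L_4,\qquad \{\mathcal L_2,\mathcal R\}=-16p^2\mathcal L_2\mathcal L_4,$$ $$\{\mathcal L_4,\mathcal R\}=8p^2\mathcal L_4^2-32p^2\frac{\partial P}{\partial \mathcal L_2}(\mathcal L_2,\mathcal H),\qquad \mathcal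 R^2=-16p^2\mathcal L_2\mathcal L_4^2+64p^2P(\mathcal L_2,\mathcal H)$$ hold, and the symmetry algebra generated by $\mathcal H,\mathcal L_2,\mathcal L_3,\mathcal L_4$ closes: each of its elements is a polynomial in $\mathcal H,\mathcal L_2,\mathcal L_4,\mathcal R$. 3. There is a constant of the motion $\mathcal L_5$, polynomial in the momenta, of order $2(p+q)-2$, one less than the order of $\mathcal L_4$, with $$\mathcal L_5=\frac{\mathcal L_3-2(-1)^{\lfloor (q-p)/2\rfloor}(\alpha-\beta)^q\,\mathcal H^p}{\mathcal L_2}\qquad\text{wherever }\mathcal L_2\neq0 .$$ The functions $\mathcal H,\mathcal L_2,\mathcal L_5$ are functionally independent. They generate a symmetry algebra that closes (each of its elements is a polynomial in $\mathcal H,\mathcal L_2,\mathcal L_5,\{\mathcal L_2,\mathcal L_5\}$) and that properly contains the algebra generated by $\mathcal H,\mathcal L_2,\mathcal L_3,\mathcal L_4$. -/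

import Mathlib

noncomputable section

/-! ### Hamiltonian mechanics on the phase space of `n` positions and `n` momenta over `𝕜 = ℝ, ℂ` -/

/-- Phase space: a point `z` has positions `z.1` and momenta `z.2`. -/
abbrev PhaseSpace (𝕜 : Type*) (n : ℕ) : Type _ := (Fin n → 𝕜) × (Fin n → 𝕜)

/-- The part of phase space lying over a set `D` of positions. -/
def phaseOver {𝕜 : Type*} {n : ℕ} (D : Set (Fin n → 𝕜)) : Set (PhaseSpace 𝕜 n) :=
  {z | z.1 ∈ D}

/-- `∂F/∂q_j`. -/
def partialPos {𝕜 : Type*} [RCLike 𝕜] {n : ℕ} (j : Fin n) (F : PhaseSpace 𝕜 n → 𝕜)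
    (z : PhaseSpace 𝕜 n) : 𝕜 :=
  fderiv 𝕜 F z (Pi.single j 1, 0)

/-- `∂F/∂p_j`. -/
def partialMom {𝕜 : Type*} [RCLike 𝕜] {n : ℕ} (j : Fin n) (F : PhaseSpace 𝕜 n → 𝕜)
    (z : PhaseSpace 𝕜 n) : 𝕜 :=
  fderiv 𝕜 F z (0, Pi.single j 1)

/-- The Poisson bracket `{F, G} = ∑ j, (∂F/∂p_j ∂G/∂q_j - ∂F/∂q_j ∂G/∂p_j)`. -/
def poisson {𝕜 : Type*} [RCLike 𝕜] {n : ℕ} (F G : PhaseSpace 𝕜 n → 𝕜)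
    (z : PhaseSpace 𝕜 n) : 𝕜 :=
  ∑ j : Fin n, (partialMom j F z * partialPos j G z - partialPos j F z * partialMom j G z)

/-- `F` is a constant of the motion of the Hamiltonian `H` on the open set `U`. -/
def IsConstantOfMotion {𝕜 : Type*} [RCLike 𝕜] {n : ℕ} (U : Set (PhaseSpace 𝕜 n))
    (H F : PhaseSpace 𝕜 n → 𝕜) : Prop :=
  AnalyticOnNhd 𝕜 F U ∧ ∀ z ∈ U, poisson H F z = 0

/-- Over `D`, the function `F` is the polynomial `c` in the momenta; the coefficients of `c` are
functions of the positions, analytic on `D`. -/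
def IsMomentumExpansion {𝕜 : Type*} [RCLike 𝕜] {n : ℕ} (D : Set (Fin n → 𝕜))
    (F : PhaseSpace 𝕜 n → 𝕜) (c : MvPolynomial (Fin n) ((Fin n → 𝕜) → 𝕜)) : Prop :=
  (∀ m, AnalyticOnNhd 𝕜 (c.coeff m) D) ∧
  ∀ z ∈ phaseOver D, F z = c.eval₂ (Pi.evalRingHom (fun _ => 𝕜) z.1) z.2

/-- `F` is polynomial in the momenta over `D`. -/
def IsPolynomialInMomenta {𝕜 : Type*} [RCLike 𝕜] {n : ℕ} (D : Set (Fin n → 𝕜))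
    (F : PhaseSpace 𝕜 n → 𝕜) : Prop :=
  ∃ c, IsMomentumExpansion D F c

/-- `F` is polynomial in the momenta over `D`, of order (degree in the momenta) exactly `N`. -/
def HasMomentumOrder {𝕜 : Type*} [RCLike 𝕜] {n : ℕ} (D : Set (Fin n → 𝕜))
    (F : PhaseSpace 𝕜 n → 𝕜) (N : ℕ) : Prop :=
  ∃ c, IsMomentumExpansion D F c ∧
    (∀ m, N < m.degree → ∀ x ∈ D, c.coeff m x = 0) ∧
    ∃ m, m.degree = N ∧ ∃ x ∈ D, c.coeff m x ≠ 0

/-- Functional independence on a region `V`: the functions are analytic there and their Jacobian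
matrix has full rank (its rows are linearly independent) throughout `V`. -/
def FunctionallyIndependentOn {𝕜 : Type*} [RCLike 𝕜] {n N : ℕ} (V : Set (PhaseSpace 𝕜 n))
    (f : Fin N → PhaseSpace 𝕜 n → 𝕜) : Prop :=
  (∀ i, AnalyticOnNhd 𝕜 (f i) V) ∧
  ∀ z ∈ V, LinearIndependent 𝕜 (fun i => fderiv 𝕜 (f i) z)

/-- The functions are functionally independent on an open dense part of `U`. -/
def GenericallyIndependent {𝕜 : Type*} [RCLike 𝕜] {n N : ℕ} (U : Set (PhaseSpace 𝕜 n))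
    (f : Fin N → PhaseSpace 𝕜 n → 𝕜) : Prop :=
  ∃ V ⊆ U, IsOpen V ∧ U ⊆ closure V ∧ FunctionallyIndependentOn V f

/-- Maximal polynomial superintegrability: there are `2n - 1` functionally independent constants of
the motion that are polynomial in the momenta. -/
def IsMaximallySuperintegrable {𝕜 : Type*} [RCLike 𝕜] {n : ℕ} (D : Set (Fin n → 𝕜))
    (H : PhaseSpace 𝕜 n → 𝕜) : Prop :=
  ∃ f : Fin (2 * n - 1) → PhaseSpace 𝕜 n → 𝕜,
    (∀ i, IsConstantOfMotion (phaseOver D) H (f i) ∧ IsPolynomialInMomenta D (f i)) ∧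
    GenericallyIndependent (phaseOver D) f

/-- Membership in the symmetry algebra generated by `S`: finite combinations of scalar multiples,
sums, products and Poisson brackets. Functions count only through their values on `U`. -/
inductive InSymmetryAlgebra {𝕜 : Type*} [RCLike 𝕜] {n : ℕ} (U : Set (PhaseSpace 𝕜 n))
    (S : Set (PhaseSpace 𝕜 n → 𝕜)) : (PhaseSpace 𝕜 n → 𝕜) → Prop
  | generator {F} : F ∈ S → InSymmetryAlgebra U S F
  | smul (a : 𝕜) {F} : InSymmetryAlgebra U S F → InSymmetryAlgebra U S (fun z => a * F z)
  | sum {F G} : InSymmetryAlgebra U S F → InSymmetryAlgebra U S G →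
      InSymmetryAlgebra U S (fun z => F z + G z)
  | prod {F G} : InSymmetryAlgebra U S F → InSymmetryAlgebra U S G →
      InSymmetryAlgebra U S (fun z => F z * G z)
  | bracket {F G} : InSymmetryAlgebra U S F → InSymmetryAlgebra U S G →
      InSymmetryAlgebra U S (poisson F G)
  | congr {F G} : InSymmetryAlgebra U S F → Set.EqOn F G U → InSymmetryAlgebra U S G

/-- The symmetry algebra generated by `S` on `U`. -/
def symmetryAlgebra {𝕜 : Type*} [RCLike 𝕜] {n : ℕ} (U : Set (PhaseSpace 𝕜 n))
    (S : Set (PhaseSpace 𝕜 n → 𝕜)) : Set (PhaseSpace 𝕜 n → 𝕜) :=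
  {F | InSymmetryAlgebra U S F}

/-- On `U`, every element of `A` is a polynomial in the functions `g 0, …, g (N - 1)`. -/
def ConsistsOfPolynomialsIn {𝕜 : Type*} [RCLike 𝕜] {n N : ℕ} (U : Set (PhaseSpace 𝕜 n))
    (A : Set (PhaseSpace 𝕜 n → 𝕜)) (g : Fin N → PhaseSpace 𝕜 n → 𝕜) : Prop :=
  ∀ F ∈ A, ∃ Φ : MvPolynomial (Fin N) 𝕜, ∀ z ∈ U, F z = Φ.eval (fun i => g i z)

/-! ### Sine and cosine on `𝕜 = ℝ, ℂ` -/

/-- The inclusion of `𝕜` in `ℂ` (the identity for `𝕜 = ℂ`). -/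
def toCx {𝕜 : Type*} [RCLike 𝕜] (x : 𝕜) : ℂ := RCLike.map 𝕜 ℂ x

/-- The sine function of `𝕜`. -/
def sinK {𝕜 : Type*} [RCLike 𝕜] (x : 𝕜) : 𝕜 := RCLike.map ℂ 𝕜 (Complex.sin (toCx x))

/-- The cosine function of `𝕜`. -/
def cosK {𝕜 : Type*} [RCLike 𝕜] (x : 𝕜) : 𝕜 := RCLike.map ℂ 𝕜 (Complex.cos (toCx x))

theorem toCx_real (x : ℝ) : toCx x = (x : ℂ) := by simp [toCx]

theorem toCx_complex (x : ℂ) : toCx x = x := by simp [toCx]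

theorem sinK_real (x : ℝ) : sinK x = Real.sin x := by
  simp [sinK, toCx, ← Complex.ofReal_sin]

theorem cosK_real (x : ℝ) : cosK x = Real.cos x := by
  simp [cosK, toCx, ← Complex.ofReal_cos]

theorem sinK_complex (x : ℂ) : sinK x = Complex.sin x := by
  simp [sinK, toCx]

theorem cosK_complex (x : ℂ) : cosK x = Complex.cos x := by
  simp [cosK, toCx]

/-! ### The TTW system

The positions are the polar coordinates `z.1 0 = r`, `z.1 1 = θ`, with conjugate momenta
`z.2 0 = p_r`, `z.2 1 = p_θ`. In terms of `r = e^R` one has `p_R = r p_r`, so that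
`e^{-2R} = 1 / r^2` and `e^{-2R} p_R = p_r / r`. -/

/-- The positions where the potential is regular. -/
def ttwDomain {𝕜 : Type*} [RCLike 𝕜] (k : 𝕜) : Set (Fin 2 → 𝕜) :=
  {x | x 0 ≠ 0 ∧ sinK (k * x 1) ≠ 0 ∧ cosK (k * x 1) ≠ 0}

/-- `L₂ = p_θ² + α / cos²(kθ) + β / sin²(kθ)`. -/
def ttwL2 {𝕜 : Type*} [RCLike 𝕜] (k α β : 𝕜) (z : PhaseSpace 𝕜 2) : 𝕜 :=
  z.2 1 ^ 2 + α / cosK (k * z.1 1) ^ 2 + β / sinK (k * z.1 1) ^ 2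

/-- `H = p_r² + p_θ² / r² + ω² r² + (α / cos²(kθ) + β / sin²(kθ)) / r²`. -/
def ttwH {𝕜 : Type*} [RCLike 𝕜] (k α β ω : 𝕜) (z : PhaseSpace 𝕜 2) : 𝕜 :=
  z.2 0 ^ 2 + 1 / z.1 0 ^ 2 * z.2 1 ^ 2 + ω ^ 2 * z.1 0 ^ 2 +
    1 / z.1 0 ^ 2 * (α / cosK (k * z.1 1) ^ 2 + β / sinK (k * z.1 1) ^ 2)

/-- `X = s sin(2kθ) p_θ + j (-β + α - L₂ cos(2kθ))`, where `s` stands for `√L₂` and `j` for `i`;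
the choice `j = -i` gives the conjugate of `X`. -/
def ttwX {𝕜 : Type*} [RCLike 𝕜] (k α β : 𝕜) (s j : ℂ) (z : PhaseSpace 𝕜 2) : ℂ :=
  s * toCx (sinK (2 * k * z.1 1) * z.2 1) +
    j * toCx (-β + α - ttwL2 k α β z * cosK (2 * k * z.1 1))

/-- `Y = 2 s p_r / r + j (2 L₂ / r² - H)`, where `s` stands for `√L₂` and `j` for `i`;
the choice `j = -i` gives the conjugate of `Y`. -/
def ttwY {𝕜 : Type*} [RCLike 𝕜] (k α β ω : 𝕜) (s j : ℂ) (z : PhaseSpace 𝕜 2) : ℂ :=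
  2 * s * toCx (z.2 0 / z.1 0) +
    j * toCx (2 * ttwL2 k α β z / z.1 0 ^ 2 - ttwH k α β ω z)

/-- `L⁺ = X^q Y^p`, with `s` standing for `√L₂`. -/
def ttwLplus {𝕜 : Type*} [RCLike 𝕜] (p q : ℕ) (k α β ω : 𝕜) (s : ℂ) (z : PhaseSpace 𝕜 2) : ℂ :=
  ttwX k α β s Complex.I z ^ q * ttwY k α β ω s Complex.I z ^ p

/-- `L⁻`, the product of the `q`-th power of the conjugate of `X` and the `p`-th power of the
conjugate of `Y`, with `s` standing for `√L₂`. -/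
def ttwLminus {𝕜 : Type*} [RCLike 𝕜] (p q : ℕ) (k α β ω : 𝕜) (s : ℂ) (z : PhaseSpace 𝕜 2) : ℂ :=
  ttwX k α β s (-Complex.I) z ^ q * ttwY k α β ω s (-Complex.I) z ^ p

/-- `P(l, h) = ((l - α - β)² - 4αβ)^q (h² - 4ω² l)^p`. -/
def ttwP {𝕜 : Type*} [RCLike 𝕜] (p q : ℕ) (α β ω l h : 𝕜) : 𝕜 :=
  ((l - α - β) ^ 2 - 4 * α * β) ^ q * (h ^ 2 - 4 * ω ^ 2 * l) ^ p

end

/-! The square root is removed first. Put t = -i√L₂, so t² = -L₂. Then X = i(b + ta) and Y = i(d +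
tc) with a, b, c, d polynomial in the momenta. Hence L⁺ = i^(p+q) (A + tB) and L⁻ = (-i)^(p+q) (A -
tB), where A + tB = (b + ta)^q (d + tc)^p is computed in the quadratic algebra `TTWAlgebra`. Up to
one common sign L₃ = 2A and L₄ = 2B, and these make sense also where L₂ = 0.

Everything about A and B then follows from properties that pass to products. Brackets: for E = L₂ or
E = H the bracket with E multiplies each factor by -gt, and the g add up
(`TTWAlgebra.IsEigenvector.mul`). For L₂ the total is 4qk = 4p; for H the contributions 4qk/r² and
-4p/r² cancel. Norm: A² + L₂B² is multiplicative, which gives L₃² + L₂L₄² = 4P. Order: the leading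
coefficients in p_θ combine by the addition theorems to r^(-2p) cos 2pθ and r^(-2p) sin 2pθ up to
sign. Reduction modulo L₂: b = α - β, d = -H and t² = 0, so A is congruent to (α - β)^q (-H)^p, and
the quotient gives L₅ (`TTWAlgebra.HasLead.mul`).

Independence holds because the bracket with L₂ kills H and L₂ but, generically, not the third
function (`genericallyIndependent_of_poisson`). The brackets still missing come from differentiating
the quadratic relation and cancelling L₂ or L₃, which are nonzero on dense sets; closure follows
since the bracket is a derivation.

The inclusion of algebras is proper (`IsTTWSystem.L5_notMem`): if L₅ were in the smaller one, then
4P - L₂L₄² times a nonzero square would be a square in the polynomial ring in H, L₂, L₄. A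
substitution giving it odd degree excludes this. -/

noncomputable section

/-! ### The trigonometric functions of `𝕜` -/

section Trigonometry

variable {𝕜 : Type*} [RCLike 𝕜]

/-- `toCx` as a ring homomorphism. -/
def toCxHom (𝕜 : Type*) [RCLike 𝕜] : 𝕜 →+* ℂ where
  toFun := toCx
  map_one' := by simp [toCx]
  map_zero' := by simp [toCx]
  map_mul' x y := by apply Complex.ext <;> simp [toCx]
  map_add' x y := by apply Complex.ext <;> simp [toCx]

theorem toCxHom_apply (x : 𝕜) : toCxHom 𝕜 x = toCx x := rfl

theorem norm_toCx (x : 𝕜) : ‖toCx x‖ = ‖x‖ := by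
  rw [← sq_eq_sq₀ (norm_nonneg _) (norm_nonneg _), RCLike.norm_sq_eq_def, RCLike.norm_sq_eq_def]
  simp [toCx]

theorem isometry_toCxHom : Isometry (toCxHom 𝕜) :=
  AddMonoidHomClass.isometry_of_norm _ norm_toCx

theorem toCx_injective : Function.Injective (toCx : 𝕜 → ℂ) :=
  (isometry_toCxHom (𝕜 := 𝕜)).injective

theorem toCx_add (x y : 𝕜) : toCx (x + y) = toCx x + toCx y := map_add (toCxHom 𝕜) x y
theorem toCx_sub (x y : 𝕜) : toCx (x - y) = toCx x - toCx y := map_sub (toCxHom 𝕜) x y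
theorem toCx_mul (x y : 𝕜) : toCx (x * y) = toCx x * toCx y := map_mul (toCxHom 𝕜) x y
theorem toCx_neg (x : 𝕜) : toCx (-x) = -toCx x := map_neg (toCxHom 𝕜) x
theorem toCx_pow (x : 𝕜) (n : ℕ) : toCx (x ^ n) = toCx x ^ n := map_pow (toCxHom 𝕜) x n
theorem toCx_one : toCx (1 : 𝕜) = 1 := map_one (toCxHom 𝕜)
theorem toCx_zero : toCx (0 : 𝕜) = 0 := map_zero (toCxHom 𝕜)
theorem toCx_two : toCx (2 : 𝕜) = 2 := map_ofNat (toCxHom 𝕜) 2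

/-- `I = 0` is the real case, where passing from ℂ to 𝕜 drops the imaginary part; otherwise nothing
is lost. -/
theorem toCx_map_of_conj_fixed (w : ℂ) (h : (RCLike.I : 𝕜) = 0 → w.im = 0) :
    toCx (RCLike.map ℂ 𝕜 w) = w := by
  rcases RCLike.I_eq_zero_or_im_I_eq_one (K := 𝕜) with h0 | h1
  · apply Complex.ext <;> simp [toCx, h0, h h0]
  · have hre : RCLike.re (RCLike.I : 𝕜) = 0 := RCLike.I_re
    apply Complex.ext <;> simp [toCx, h1]

theorem toCx_im_of_I_eq_zero (h : (RCLike.I : 𝕜) = 0) (x : 𝕜) : (toCx x).im = 0 := by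
  simp [toCx, RCLike.im_eq_zero h]

theorem toCx_eq_re_of_I_eq_zero (h : (RCLike.I : 𝕜) = 0) (x : 𝕜) :
    toCx x = ((toCx x).re : ℂ) := by
  apply Complex.ext <;> simp [toCx_im_of_I_eq_zero h]

theorem toCx_sinK (x : 𝕜) : toCx (sinK x) = Complex.sin (toCx x) := by
  refine toCx_map_of_conj_fixed _ fun h => ?_
  rw [toCx_eq_re_of_I_eq_zero h, ← Complex.ofReal_sin, Complex.ofReal_im]

theorem toCx_cosK (x : 𝕜) : toCx (cosK x) = Complex.cos (toCx x) := by
  refine toCx_map_of_conj_fixed _ fun h => ?_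
  rw [toCx_eq_re_of_I_eq_zero h, ← Complex.ofReal_cos, Complex.ofReal_im]

theorem sinK_add (x y : 𝕜) : sinK (x + y) = sinK x * cosK y + cosK x * sinK y :=
  toCx_injective <| by simp [toCx_add, toCx_mul, toCx_sinK, toCx_cosK, Complex.sin_add]

theorem cosK_add (x y : 𝕜) : cosK (x + y) = cosK x * cosK y - sinK x * sinK y :=
  toCx_injective <| by simp [toCx_add, toCx_sub, toCx_mul, toCx_sinK, toCx_cosK, Complex.cos_add]

theorem sinK_sq_add_cosK_sq (x : 𝕜) : sinK x ^ 2 + cosK x ^ 2 = 1 :=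
  toCx_injective <| by simp [toCx_add, toCx_pow, toCx_sinK, toCx_cosK, toCx_one]

theorem sinK_two_mul (x : 𝕜) : sinK (2 * x) = 2 * sinK x * cosK x := by
  rw [two_mul, sinK_add]; ring

theorem cosK_two_mul (x : 𝕜) : cosK (2 * x) = cosK x ^ 2 - sinK x ^ 2 := by
  rw [two_mul, cosK_add]; ring

theorem sinK_one_ne_zero : sinK (1 : 𝕜) ≠ 0 := by
  intro h
  have h1 := toCx_sinK (1 : 𝕜)
  rw [h, toCx_zero, toCx_one] at h1
  have h2 : Real.sin 1 = 0 := by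
    have : ((Real.sin 1 : ℝ) : ℂ) = 0 := by rw [Complex.ofReal_sin, Complex.ofReal_one, ← h1]
    exact_mod_cast this
  exact (Real.sin_pos_of_pos_of_le_one one_pos le_rfl).ne' h2

theorem cosK_one_ne_zero : cosK (1 : 𝕜) ≠ 0 := by
  intro h
  have h1 := toCx_cosK (1 : 𝕜)
  rw [h, toCx_zero, toCx_one] at h1
  have h2 : Real.cos 1 = 0 := by
    have : ((Real.cos 1 : ℝ) : ℂ) = 0 := by rw [Complex.ofReal_cos, Complex.ofReal_one, ← h1]
    exact_mod_cast this
  exact Real.cos_one_pos.ne' h2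

/-! ### Analyticity and derivatives of sine and cosine, transferred from ℂ -/

theorem analyticOnNhd_of_hasSum_pow {c : ℕ → 𝕜} {f : 𝕜 → 𝕜}
    (h : ∀ x, HasSum (fun n => c n * x ^ n) (f x)) : AnalyticOnNhd 𝕜 f Set.univ := by
  have hf : HasFPowerSeriesOnBall f (FormalMultilinearSeries.ofScalars 𝕜 c) 0 ⊤ := by
    refine ⟨?_, ENNReal.zero_lt_top, fun {y} _ => ?_⟩
    · refine (FormalMultilinearSeries.radius_eq_top_of_summable_norm _ fun r => ?_).ge
      have := (h (r : ℝ)).summable.norm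
      simpa [FormalMultilinearSeries.ofScalars_norm] using this
    · simpa [FormalMultilinearSeries.ofScalars_apply_eq, mul_comm] using h y
  simpa using hf.analyticOnNhd

/-- An isometric embedding induces the topology of its source, so convergence may be tested in ℂ. -/
theorem hasSum_of_toCx {f : ℕ → 𝕜} {x : 𝕜} (h : HasSum (fun n => toCx (f n)) (toCx x)) :
    HasSum f x :=
  ((isometry_toCxHom (𝕜 := 𝕜)).isUniformInducing.isInducing.hasSum_iff f x).mp h

theorem hasSum_sinK (x : 𝕜) :
    HasSum (fun n : ℕ => (if Even n then 0 else (-1) ^ (n / 2) / (n.factorial : 𝕜)) * x ^ n)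
      (sinK x) := by
  apply hasSum_of_toCx
  rw [toCx_sinK, ← zero_add (Complex.sin _)]
  refine HasSum.even_add_odd ?_ ?_
  · simp [toCx_zero, hasSum_zero]
  · convert Complex.hasSum_sin (toCx x) using 2 with n
    have : ¬ Even (2 * n + 1) := by simp
    have h2 : (2 * n + 1) / 2 = n := by omega
    simp only [this, if_false, h2, ← toCxHom_apply]
    simp only [map_mul, map_div₀, map_pow, map_neg, map_one, map_natCast]
    ring

theorem hasSum_cosK (x : 𝕜) :
    HasSum (fun n : ℕ => (if Even n then (-1) ^ (n / 2) / (n.factorial : 𝕜) else 0) * x ^ n)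
      (cosK x) := by
  apply hasSum_of_toCx
  rw [toCx_cosK, ← add_zero (Complex.cos _)]
  refine HasSum.even_add_odd ?_ ?_
  · convert Complex.hasSum_cos (toCx x) using 2 with n
    have h2 : (2 * n) / 2 = n := by omega
    simp only [even_two_mul, if_true, h2, ← toCxHom_apply]
    simp only [map_mul, map_div₀, map_pow, map_neg, map_one, map_natCast]
    ring
  · have h (n : ℕ) : ¬ Even (2 * n + 1) := by simp
    simp [h, toCx_zero, hasSum_zero]

theorem analyticAt_sinK (x : 𝕜) : AnalyticAt 𝕜 sinK x :=
  analyticOnNhd_of_hasSum_pow hasSum_sinK x trivial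

theorem analyticAt_cosK (x : 𝕜) : AnalyticAt 𝕜 cosK x :=
  analyticOnNhd_of_hasSum_pow hasSum_cosK x trivial

/-- The little-o condition for a derivative involves norms only, and `toCx` preserves them. -/
theorem hasDerivAt_of_toCx {f : 𝕜 → 𝕜} {g : ℂ → ℂ} (hfg : ∀ x, toCx (f x) = g (toCx x)) {x f' : 𝕜}
    (h : HasDerivAt g (toCx f') (toCx x)) : HasDerivAt f f' x := by
  rw [hasDerivAt_iff_isLittleO] at h ⊢
  have ht : Filter.Tendsto (toCx : 𝕜 → ℂ) (nhds x) (nhds (toCx x)) :=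
    (isometry_toCxHom (𝕜 := 𝕜)).continuous.continuousAt
  have h2 := h.comp_tendsto ht
  refine Asymptotics.IsLittleO.of_norm_norm ?_
  refine (h2.norm_norm).congr (fun y => ?_) (fun y => ?_)
  · simp only [Function.comp, ← hfg, smul_eq_mul, ← toCx_sub, ← toCx_mul, norm_toCx]
  · simp only [Function.comp, ← toCx_sub, norm_toCx]

theorem hasDerivAt_sinK (x : 𝕜) : HasDerivAt sinK (cosK x) x :=
  hasDerivAt_of_toCx toCx_sinK (by rw [toCx_cosK]; exact Complex.hasDerivAt_sin _)

theorem hasDerivAt_cosK (x : 𝕜) : HasDerivAt cosK (-sinK x) x :=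
  hasDerivAt_of_toCx toCx_cosK (by rw [toCx_neg, toCx_sinK]; exact Complex.hasDerivAt_cos _)

/-- At a zero of the sine the cosine does not vanish, so the derivative is nonzero and the zero is
isolated. -/
theorem eventually_sinK_mul_ne_zero {c : 𝕜} (hc : c ≠ 0) (x : 𝕜) :
    ∀ᶠ y in nhdsWithin x {x}ᶜ, sinK (c * y) ≠ 0 := by
  have hd : HasDerivAt (fun y => sinK (c * y)) (cosK (c * x) * c) x := by
    have h1 : HasDerivAt (fun y => c * y) c x := by simpa using (hasDerivAt_id x).const_mul c
    exact (hasDerivAt_sinK (c * x)).comp x h1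
  by_cases h : sinK (c * x) = 0
  · have hne : cosK (c * x) * c ≠ 0 := by
      refine mul_ne_zero (fun h0 => ?_) hc
      simpa [h, h0] using sinK_sq_add_cosK_sq (c * x)
    exact hd.eventually_ne hne
  · exact (hd.continuousAt.eventually_ne h).filter_mono nhdsWithin_le_nhds

end Trigonometry

/-! ### Momentum expansions -/

section MomentumExpansion

variable {𝕜 : Type*} [RCLike 𝕜] {n : ℕ} {D : Set (Fin n → 𝕜)} {F G : PhaseSpace 𝕜 n → 𝕜}

theorem IsMomentumExpansion.add {c d : MvPolynomial (Fin n) ((Fin n → 𝕜) → 𝕜)}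
    (hF : IsMomentumExpansion D F c) (hG : IsMomentumExpansion D G d) :
    IsMomentumExpansion D (fun z => F z + G z) (c + d) :=
  ⟨fun m => by simpa using (hF.1 m).add (hG.1 m), fun z hz => by
    simp [MvPolynomial.eval₂_add, hF.2 z hz, hG.2 z hz]⟩

theorem IsMomentumExpansion.mul {c d : MvPolynomial (Fin n) ((Fin n → 𝕜) → 𝕜)}
    (hF : IsMomentumExpansion D F c) (hG : IsMomentumExpansion D G d) :
    IsMomentumExpansion D (fun z => F z * G z) (c * d) := by
  classical
  refine ⟨fun m => ?_, fun z hz => by simp [MvPolynomial.eval₂_mul, hF.2 z hz, hG.2 z hz]⟩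
  rw [MvPolynomial.coeff_mul]
  exact Finset.analyticOnNhd_sum _ fun u _ => (hF.1 u.1).mul (hG.1 u.2)

theorem isMomentumExpansion_C {f : (Fin n → 𝕜) → 𝕜} (hf : AnalyticOnNhd 𝕜 f D) :
    IsMomentumExpansion D (fun z => f z.1) (MvPolynomial.C f) := by
  classical
  refine ⟨fun m => ?_, fun z _ => by simp⟩
  rw [MvPolynomial.coeff_C]
  split_ifs
  · exact hf
  · exact analyticOnNhd_const (v := (0 : 𝕜))

theorem isMomentumExpansion_X (i : Fin n) :
    IsMomentumExpansion D (fun z : PhaseSpace 𝕜 n => z.2 i) (MvPolynomial.X i) := by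
  classical
  refine ⟨fun m => ?_, fun z _ => by simp⟩
  rw [MvPolynomial.coeff_X]
  split_ifs
  · exact analyticOnNhd_const (v := (1 : 𝕜))
  · exact analyticOnNhd_const (v := (0 : 𝕜))

theorem isOpen_phaseOver (hD : IsOpen D) : IsOpen (phaseOver D : Set (PhaseSpace 𝕜 n)) :=
  hD.preimage continuous_fst

theorem IsMomentumExpansion.analyticOnNhd (hD : IsOpen D)
    {c : MvPolynomial (Fin n) ((Fin n → 𝕜) → 𝕜)} (hF : IsMomentumExpansion D F c) :
    AnalyticOnNhd 𝕜 F (phaseOver D) := by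
  have h : AnalyticOnNhd 𝕜 (fun z : PhaseSpace 𝕜 n =>
      ∑ m ∈ c.support, c.coeff m z.1 * ∏ i, z.2 i ^ m i) (phaseOver D) := by
    intro z hz
    refine Finset.analyticAt_fun_sum _ fun m _ => AnalyticAt.mul ?_ ?_
    · exact (hF.1 m z.1 hz).fun_comp analyticAt_fst
    · refine Finset.analyticAt_fun_prod _ fun i _ => AnalyticAt.pow ?_ _
      exact ((ContinuousLinearMap.proj (R := 𝕜) (φ := fun _ : Fin n => 𝕜) i).analyticAt _).fun_comp
        analyticAt_snd
  refine h.congr (isOpen_phaseOver hD) fun z hz => ?_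
  rw [hF.2 z hz, MvPolynomial.eval₂_eq']
  rfl

/-- `F` has degree at most `N` in the momenta over `D`, and the coefficient of the `N`-th power of
the momentum `i` is `g`. -/
def HasMomentumLead (D : Set (Fin n → 𝕜)) (i : Fin n) (F : PhaseSpace 𝕜 n → 𝕜) (N : ℕ)
    (g : (Fin n → 𝕜) → 𝕜) : Prop :=
  ∃ c, IsMomentumExpansion D F c ∧ (∀ m, N < m.degree → c.coeff m = 0) ∧
    ∀ x ∈ D, c.coeff (Finsupp.single i N) x = g x

variable {i : Fin n} {M N : ℕ} {f g : (Fin n → 𝕜) → 𝕜}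

theorem HasMomentumLead.congr (h : HasMomentumLead D i F N f) (hFG : Set.EqOn F G (phaseOver D))
    (hfg : Set.EqOn f g D) : HasMomentumLead D i G N g := by
  obtain ⟨c, hc, hd, hl⟩ := h
  exact ⟨c, ⟨hc.1, fun z hz => by rw [← hFG hz, hc.2 z hz]⟩, hd,
    fun x hx => by rw [hl x hx, hfg hx]⟩

theorem HasMomentumLead.add (hF : HasMomentumLead D i F N f) (hG : HasMomentumLead D i G N g) :
    HasMomentumLead D i (fun z => F z + G z) N (fun x => f x + g x) := by
  obtain ⟨c, hc, hcd, hcl⟩ := hF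
  obtain ⟨d, hd, hdd, hdl⟩ := hG
  exact ⟨c + d, hc.add hd, fun m hm => by simp [hcd m hm, hdd m hm],
    fun x hx => by simp [hcl x hx, hdl x hx]⟩

theorem eq_single_of_degree_eq {m : Fin n →₀ ℕ} (h : m i = m.degree) :
    m = Finsupp.single i m.degree := by
  classical
  rw [Finsupp.degree_eq_sum, ← Finset.add_sum_erase _ _ (Finset.mem_univ i)] at h
  have h0 : ∑ j ∈ Finset.univ.erase i, m j = 0 := by omega
  ext j
  by_cases hj : i = j
  · subst hj
    rw [Finsupp.single_eq_same, Finsupp.degree_eq_sum,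
      ← Finset.add_sum_erase _ _ (Finset.mem_univ i), h0, add_zero]
  · rw [Finsupp.single_apply, if_neg hj]
    exact Finset.sum_eq_zero_iff.mp h0 j (by simp [Ne.symm hj])

/-- In the coefficient of the top power only one product survives: both factors must have full
degree, and a sum of two monomials that is a pure power of the momentum `i` has pure powers as
summands. -/
theorem HasMomentumLead.mul (hF : HasMomentumLead D i F M f) (hG : HasMomentumLead D i G N g) :
    HasMomentumLead D i (fun z => F z * G z) (M + N) (fun x => f x * g x) := by
  classical
  obtain ⟨c, hc, hcd, hcl⟩ := hF
  obtain ⟨d, hd, hdd, hdl⟩ := hG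
  refine ⟨c * d, hc.mul hd, fun m hm => ?_, fun x hx => ?_⟩
  · rw [MvPolynomial.coeff_mul]
    refine Finset.sum_eq_zero fun u hu => ?_
    rw [← Finset.HasAntidiagonal.mem_antidiagonal.mp hu, map_add] at hm
    rcases lt_or_ge M u.1.degree with h | h
    · rw [hcd _ h, zero_mul]
    · rw [hdd u.2 (by omega), mul_zero]
  · rw [MvPolynomial.coeff_mul, Finset.sum_apply,
      Finset.sum_eq_single (Finsupp.single i M, Finsupp.single i N)]
    · rw [Pi.mul_apply, hcl x hx, hdl x hx]
    · rintro ⟨u, v⟩ huv hne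
      rw [Finset.HasAntidiagonal.mem_antidiagonal] at huv
      dsimp only at huv ⊢
      have hdeg : u.degree + v.degree = M + N := by
        rw [← map_add, huv, Finsupp.degree_single]
      rcases lt_trichotomy u.degree M with h | h | h
      · rw [hdd v (by omega), mul_zero, Pi.zero_apply]
      · have hui : u i + v i = M + N := by
          rw [← Finsupp.add_apply, huv, Finsupp.single_eq_same]
        have h1 := Finsupp.le_degree i u
        have h2 := Finsupp.le_degree i v
        exfalso
        apply hne
        rw [eq_single_of_degree_eq (i := i) (m := u) (by omega),
          eq_single_of_degree_eq (i := i) (m := v) (by omega)]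
        rw [h, show v.degree = N by omega]
      · rw [hcd u h, zero_mul, Pi.zero_apply]
    · intro h
      exact absurd (Finset.HasAntidiagonal.mem_antidiagonal.mpr (Finsupp.single_add ..).symm) h

theorem HasMomentumLead.of_position (hf : AnalyticOnNhd 𝕜 f D) :
    HasMomentumLead D i (fun z => f z.1) 0 f := by
  classical
  refine ⟨_, isMomentumExpansion_C hf, fun m hm => ?_, fun x _ => by simp⟩
  rw [MvPolynomial.coeff_C, if_neg]
  rintro rfl
  simp at hm

theorem HasMomentumLead.const (a : 𝕜) :
    HasMomentumLead D i (fun _ => a) 0 (fun _ => a) :=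
  .of_position (f := fun _ => a) analyticOnNhd_const

theorem HasMomentumLead.const_mul (a : 𝕜) (hF : HasMomentumLead D i F N f) :
    HasMomentumLead D i (fun z => a * F z) N (fun x => a * f x) := by
  simpa using (HasMomentumLead.const a).mul hF

theorem HasMomentumLead.sub (hF : HasMomentumLead D i F N f) (hG : HasMomentumLead D i G N g) :
    HasMomentumLead D i (fun z => F z - G z) N (fun x => f x - g x) := by
  simpa [sub_eq_add_neg] using hF.add (hG.const_mul (-1))

theorem HasMomentumLead.pow (hF : HasMomentumLead D i F N f) (k : ℕ) :
    HasMomentumLead D i (fun z => F z ^ k) (N * k) (fun x => f x ^ k) := by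
  induction k with
  | zero => simpa using HasMomentumLead.const (1 : 𝕜)
  | succ k ih => simpa [pow_succ, mul_add] using ih.mul hF

theorem HasMomentumLead.momentum (j : Fin n) :
    HasMomentumLead D i (fun z => z.2 j) 1 (fun _ => if j = i then 1 else 0) := by
  classical
  refine ⟨_, isMomentumExpansion_X j, fun m hm => ?_, fun x _ => ?_⟩
  · rw [MvPolynomial.coeff_X, if_neg]
    rintro rfl
    simp at hm
  · rw [MvPolynomial.coeff_X]
    by_cases h : j = i
    · simp [h]
    · have : Finsupp.single j 1 ≠ Finsupp.single i 1 := fun h' =>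
        h (Finsupp.single_left_injective one_ne_zero h')
      simp [h, this]

/-- Pads lower order terms with a zero lead, so that terms of different order can be added. -/
theorem HasMomentumLead.of_lt (hF : HasMomentumLead D i F M f) (h : M < N) :
    HasMomentumLead D i F N (fun _ => 0) := by
  obtain ⟨c, hc, hd, -⟩ := hF
  refine ⟨c, hc, fun m hm => hd m (h.trans hm), fun x _ => ?_⟩
  rw [hd _ (by simpa using h)]
  rfl

theorem HasMomentumLead.analyticOnNhd (hD : IsOpen D) (hF : HasMomentumLead D i F N f) :
    AnalyticOnNhd 𝕜 F (phaseOver D) := by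
  obtain ⟨c, hc, -⟩ := hF
  exact hc.analyticOnNhd hD

theorem HasMomentumLead.isPolynomialInMomenta (hF : HasMomentumLead D i F N f) :
    IsPolynomialInMomenta D F := by
  obtain ⟨c, hc, -⟩ := hF
  exact ⟨c, hc⟩

theorem HasMomentumLead.hasMomentumOrder (hF : HasMomentumLead D i F N f)
    (h : ∃ x ∈ D, f x ≠ 0) : HasMomentumOrder D F N := by
  obtain ⟨c, hc, hd, hl⟩ := hF
  obtain ⟨x, hx, hfx⟩ := h
  exact ⟨c, hc, fun m hm x _ => by rw [hd m hm]; rfl, Finsupp.single i N, by simp, x, hx,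
    by rwa [hl x hx]⟩

/-- Over a position where the leading coefficient does not vanish, the function vanishes for
finitely many values of the distinguished momentum only. -/
theorem HasMomentumLead.mem_closure_ne_zero (hF : HasMomentumLead D i F N f)
    {z : PhaseSpace 𝕜 n} (hz : z.1 ∈ D) (hfz : f z.1 ≠ 0) :
    z ∈ closure {w | w ∈ phaseOver D ∧ F w ≠ 0} := by
  classical
  obtain ⟨c, hc, hd, hl⟩ := hF
  -- `Q` is `F` as a polynomial in the momentum `i` alone, with the positions and the other momenta
  -- frozen at `z`.
  let Q : Polynomial 𝕜 := c.eval₂ (Polynomial.C.comp (Pi.evalRingHom (fun _ => 𝕜) z.1))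
    (Function.update (fun j => Polynomial.C (z.2 j)) i Polynomial.X)
  have heval (y : 𝕜) : Q.eval y = F (z.1, Function.update z.2 i y) := by
    rw [hc.2 (z.1, Function.update z.2 i y) hz, ← Polynomial.coe_evalRingHom,
      MvPolynomial.hom_eval₂]
    congr 1
    · ext
      simp
    · ext j
      by_cases h : j = i
      · subst h; simp
      · simp [h]
  have hcoeff : Q.coeff N = f z.1 := by
    have hprod (m : Fin n →₀ ℕ) :
        ∏ j, Function.update (fun j => Polynomial.C (z.2 j)) i Polynomial.X j ^ m j =
        Polynomial.C (∏ j ∈ Finset.univ.erase i, z.2 j ^ m j) * Polynomial.X ^ m i := by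
      rw [← Finset.mul_prod_erase _ _ (Finset.mem_univ i), mul_comm, map_prod]
      congr 1
      · refine Finset.prod_congr rfl fun j hj => ?_
        simp [Finset.ne_of_mem_erase hj]
      · simp
    rw [← hl z.1 hz]
    simp only [Q, MvPolynomial.eval₂_eq', hprod, Polynomial.finsetSum_coeff]
    rw [Finset.sum_eq_single (Finsupp.single i N)]
    · have : ∏ j ∈ Finset.univ.erase i, z.2 j ^ (Finsupp.single i N) j = 1 :=
        Finset.prod_eq_one fun j hj => by simp [Finset.ne_of_mem_erase hj]
      simp [this]
    -- A monomial of total degree at most `N` containing the `N`-th power of the momentum `i` can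
    -- contain nothing else.
    · intro m hm hne
      have hdm : m.degree ≤ N := by
        by_contra h
        exact MvPolynomial.mem_support_iff.mp hm (hd m (not_le.mp h))
      have hle := Finsupp.le_degree i m
      have hmi : m i ≠ N := by
        intro h
        apply hne
        have h2 : m.degree = N := by omega
        rw [eq_single_of_degree_eq (i := i) (m := m) (by omega), h2]
      simp only [RingHom.comp_apply, Polynomial.coeff_C_mul, Polynomial.coeff_X_pow,
        if_neg hmi.symm, mul_zero]
    · intro h
      simp [MvPolynomial.notMem_support_iff.mp h]
  have hQ : Q ≠ 0 := by
    rintro h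
    rw [h, Polynomial.coeff_zero] at hcoeff
    exact hfz hcoeff.symm
  have hev : ∀ᶠ y in nhdsWithin (z.2 i) {z.2 i}ᶜ, Q.eval y ≠ 0 := by
    have hfin : (Q.rootSet 𝕜).Finite := Q.rootSet_finite 𝕜
    -- The point `z.2 i` may itself be a root, so it is taken out of the finite set that is avoided.
    have : ∀ᶠ y in nhdsWithin (z.2 i) {z.2 i}ᶜ, y ∉ Q.rootSet 𝕜 \ {z.2 i} :=
      ((hfin.subset Set.sdiff_subset).isClosed.isOpen_compl.mem_nhds (by simp) :
        _ ∈ nhds (z.2 i)) |> fun h => nhdsWithin_le_nhds h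
    filter_upwards [this, self_mem_nhdsWithin] with y hy hy' h0
    exact hy ⟨by simp [Polynomial.mem_rootSet, hQ, h0], hy'⟩
  have hcont : Filter.Tendsto (fun y => (z.1, Function.update z.2 i y))
      (nhdsWithin (z.2 i) {z.2 i}ᶜ) (nhds z) := by
    have : Continuous fun y : 𝕜 => (z.1, Function.update z.2 i y) := by fun_prop
    have h := this.tendsto (z.2 i)
    simp only [Function.update_eq_self] at h
    exact h.mono_left nhdsWithin_le_nhds
  refine mem_closure_of_tendsto hcont ?_
  filter_upwards [hev] with y hy
  exact ⟨hz, by rwa [← heval]⟩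

end MomentumExpansion

/-! ### The Poisson bracket as a derivation -/

section Poisson

variable {𝕜 : Type*} [RCLike 𝕜] {n : ℕ} {F G H K : PhaseSpace 𝕜 n → 𝕜} {z : PhaseSpace 𝕜 n}
  {U : Set (PhaseSpace 𝕜 n)}

theorem poisson_antisymm (F G : PhaseSpace 𝕜 n → 𝕜) (z : PhaseSpace 𝕜 n) :
    poisson F G z = -poisson G F z := by
  rw [poisson, poisson, ← Finset.sum_neg_distrib]
  exact Finset.sum_congr rfl fun j _ => by ring

theorem poisson_self (F : PhaseSpace 𝕜 n → 𝕜) (z : PhaseSpace 𝕜 n) : poisson F F z = 0 :=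
  Finset.sum_eq_zero fun j _ => by ring

theorem poisson_eq_zero_of_fderiv (h : fderiv 𝕜 G z = 0) : poisson F G z = 0 :=
  Finset.sum_eq_zero fun j _ => by simp [partialPos, partialMom, h]

theorem poisson_congr (hU : IsOpen U) (hF : Set.EqOn F H U) (hG : Set.EqOn G K U) (hz : z ∈ U) :
    poisson F G z = poisson H K z := by
  simp only [poisson, partialPos, partialMom,
    (hF.eventuallyEq_of_mem (hU.mem_nhds hz)).fderiv_eq,
    (hG.eventuallyEq_of_mem (hU.mem_nhds hz)).fderiv_eq]

theorem poisson_const (a : 𝕜) : poisson H (fun _ => a) z = 0 :=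
  poisson_eq_zero_of_fderiv (by simp)

theorem poisson_add (hF : DifferentiableAt 𝕜 F z) (hG : DifferentiableAt 𝕜 G z) :
    poisson H (fun w => F w + G w) z = poisson H F z + poisson H G z := by
  simp only [poisson, partialPos, partialMom, fderiv_fun_add hF hG, ← Finset.sum_add_distrib]
  refine Finset.sum_congr rfl fun j _ => ?_
  simp only [add_apply]
  ring

theorem poisson_mul (hF : DifferentiableAt 𝕜 F z) (hG : DifferentiableAt 𝕜 G z) :
    poisson H (fun w => F w * G w) z = F z * poisson H G z + G z * poisson H F z := by
  simp only [poisson, partialPos, partialMom, fderiv_fun_mul hF hG, Finset.mul_sum,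
    ← Finset.sum_add_distrib]
  refine Finset.sum_congr rfl fun j _ => ?_
  simp only [add_apply, smul_apply, smul_eq_mul]
  ring

theorem poisson_const_mul (a : 𝕜) (hF : DifferentiableAt 𝕜 F z) :
    poisson H (fun w => a * F w) z = a * poisson H F z := by
  rw [poisson_mul (differentiableAt_const a) hF, poisson_const, mul_zero, add_zero]

theorem poisson_sub (hF : DifferentiableAt 𝕜 F z) (hG : DifferentiableAt 𝕜 G z) :
    poisson H (fun w => F w - G w) z = poisson H F z - poisson H G z := by
  have h := poisson_add (H := H) hF (hG.const_mul (-1))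
  rw [poisson_const_mul _ hG] at h
  simpa [sub_eq_add_neg] using h

theorem poisson_comp {φ : 𝕜 → 𝕜} {φ' : 𝕜} (hφ : HasDerivAt φ φ' (F z))
    (hF : DifferentiableAt 𝕜 F z) :
    poisson H (fun w => φ (F w)) z = φ' * poisson H F z := by
  have h : fderiv 𝕜 (fun w => φ (F w)) z = φ' • fderiv 𝕜 F z :=
    (hφ.comp_hasFDerivAt z hF.hasFDerivAt).fderiv
  simp only [poisson, partialPos, partialMom, h, Finset.mul_sum]
  refine Finset.sum_congr rfl fun j _ => ?_
  simp only [smul_apply, smul_eq_mul]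
  ring

theorem poisson_pow (hF : DifferentiableAt 𝕜 F z) (k : ℕ) :
    poisson H (fun w => F w ^ k) z = k * F z ^ (k - 1) * poisson H F z :=
  poisson_comp (φ := fun x => x ^ k) (hasDerivAt_pow k (F z)) hF

/-- Needed to extend identities between brackets from a dense set to all of `U`. -/
theorem continuousOn_poisson (hF : AnalyticOnNhd 𝕜 F U) (hG : AnalyticOnNhd 𝕜 G U) :
    ContinuousOn (poisson F G) U := by
  have h1 := hF.fderiv.continuousOn
  have h2 := hG.fderiv.continuousOn
  unfold poisson partialPos partialMom
  fun_prop

theorem fderiv_position (j : Fin n) (v : PhaseSpace 𝕜 n) :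
    fderiv 𝕜 (fun w : PhaseSpace 𝕜 n => w.1 j) z v = v.1 j := by
  have : HasFDerivAt (fun w : PhaseSpace 𝕜 n => w.1 j)
      ((ContinuousLinearMap.proj (R := 𝕜) (φ := fun _ : Fin n => 𝕜) j).comp
        (ContinuousLinearMap.fst 𝕜 _ _)) z :=
    ((ContinuousLinearMap.proj (R := 𝕜) (φ := fun _ : Fin n => 𝕜) j).comp
      (ContinuousLinearMap.fst 𝕜 (Fin n → 𝕜) (Fin n → 𝕜))).hasFDerivAt (x := z)
  rw [this.fderiv]
  rfl

theorem fderiv_momentum (j : Fin n) (v : PhaseSpace 𝕜 n) :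
    fderiv 𝕜 (fun w : PhaseSpace 𝕜 n => w.2 j) z v = v.2 j := by
  have : HasFDerivAt (fun w : PhaseSpace 𝕜 n => w.2 j)
      ((ContinuousLinearMap.proj (R := 𝕜) (φ := fun _ : Fin n => 𝕜) j).comp
        (ContinuousLinearMap.snd 𝕜 _ _)) z :=
    ((ContinuousLinearMap.proj (R := 𝕜) (φ := fun _ : Fin n => 𝕜) j).comp
      (ContinuousLinearMap.snd 𝕜 (Fin n → 𝕜) (Fin n → 𝕜))).hasFDerivAt (x := z)
  rw [this.fderiv]
  rfl

theorem poisson_position (j : Fin n) :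
    poisson F (fun w => w.1 j) z = partialMom j F z := by
  simp [poisson, partialPos, partialMom, fderiv_position, Pi.single_apply]

theorem poisson_momentum (j : Fin n) :
    poisson F (fun w => w.2 j) z = -partialPos j F z := by
  simp [poisson, partialPos, partialMom, fderiv_momentum, Pi.single_apply]

end Poisson

/-! ### Dense open subsets of a region -/

section Dense

variable {X : Type*} [TopologicalSpace X] {U V W : Set X}

theorem subset_closure_inter_of_isOpen (hV : IsOpen V) (hUV : U ⊆ closure V) (hVU : V ⊆ U)
    (hUW : U ⊆ closure W) : U ⊆ closure (V ∩ W) := by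
  refine hUV.trans (closure_minimal ?_ isClosed_closure)
  exact fun x hx => hV.inter_closure ⟨hx, hUW (hVU hx)⟩

theorem isOpen_setOf_mem_and_ne_zero {𝕜 : Type*} [RCLike 𝕜] (hU : IsOpen U) {F : X → 𝕜}
    (hF : ContinuousOn F U) : IsOpen {x | x ∈ U ∧ F x ≠ 0} :=
  hF.isOpen_inter_preimage hU isOpen_compl_singleton

theorem subset_closure_mul_ne_zero {𝕜 : Type*} [RCLike 𝕜] (hU : IsOpen U) {F G : X → 𝕜}
    (hF : ContinuousOn F U) (hFU : U ⊆ closure {x | x ∈ U ∧ F x ≠ 0})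
    (hGU : U ⊆ closure {x | x ∈ U ∧ G x ≠ 0}) :
    U ⊆ closure {x | x ∈ U ∧ F x * G x ≠ 0} := by
  refine (subset_closure_inter_of_isOpen (isOpen_setOf_mem_and_ne_zero hU hF) hFU
    (fun x hx => hx.1) hGU).trans (closure_mono ?_)
  exact fun x hx => ⟨hx.1.1, mul_ne_zero hx.1.2 hx.2.2⟩

/-- Cancellation of a generically nonzero factor; this is how division by L₂ and by L₃ is carried
out. -/
theorem eqOn_of_mul_eq_mul {𝕜 : Type*} [RCLike 𝕜] {E F G : X → 𝕜}
    (hE : U ⊆ closure {x | x ∈ U ∧ E x ≠ 0}) (hF : ContinuousOn F U) (hG : ContinuousOn G U)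
    (h : ∀ x ∈ U, E x * F x = E x * G x) : Set.EqOn F G U := by
  refine Set.EqOn.of_subset_closure (s := {x | x ∈ U ∧ E x ≠ 0}) ?_ hF hG (fun x hx => hx.1) hE
  exact fun x hx => mul_left_cancel₀ hx.2 (h x hx.1)

end Dense

/-! ### Symmetry algebras and polynomial combinations -/

section SymmetryAlgebra

variable {𝕜 : Type*} [RCLike 𝕜] {n N : ℕ} {U : Set (PhaseSpace 𝕜 n)}
  {g : Fin N → PhaseSpace 𝕜 n → 𝕜}

/-- The functions that are polynomials in `g` on `U`. -/
def polynomialsIn (U : Set (PhaseSpace 𝕜 n)) (g : Fin N → PhaseSpace 𝕜 n → 𝕜) :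
    Set (PhaseSpace 𝕜 n → 𝕜) :=
  {F | ∃ Φ : MvPolynomial (Fin N) 𝕜, ∀ z ∈ U, F z = Φ.eval (fun i => g i z)}

variable {F G : PhaseSpace 𝕜 n → 𝕜}

theorem polynomialsIn_congr (hF : F ∈ polynomialsIn U g) (h : Set.EqOn F G U) :
    G ∈ polynomialsIn U g := by
  obtain ⟨Φ, hΦ⟩ := hF
  exact ⟨Φ, fun z hz => by rw [← h hz, hΦ z hz]⟩

theorem polynomialsIn_const (a : 𝕜) : (fun _ => a) ∈ polynomialsIn U g :=
  ⟨MvPolynomial.C a, by simp⟩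

theorem polynomialsIn_gen (i : Fin N) : g i ∈ polynomialsIn U g :=
  ⟨MvPolynomial.X i, by simp⟩

theorem polynomialsIn_add (hF : F ∈ polynomialsIn U g) (hG : G ∈ polynomialsIn U g) :
    (fun z => F z + G z) ∈ polynomialsIn U g := by
  obtain ⟨Φ, hΦ⟩ := hF
  obtain ⟨Ψ, hΨ⟩ := hG
  exact ⟨Φ + Ψ, fun z hz => by simp [hΦ z hz, hΨ z hz]⟩

theorem polynomialsIn_mul (hF : F ∈ polynomialsIn U g) (hG : G ∈ polynomialsIn U g) :
    (fun z => F z * G z) ∈ polynomialsIn U g := by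
  obtain ⟨Φ, hΦ⟩ := hF
  obtain ⟨Ψ, hΨ⟩ := hG
  exact ⟨Φ * Ψ, fun z hz => by simp [hΦ z hz, hΨ z hz]⟩

theorem polynomialsIn_const_mul (a : 𝕜) (hF : F ∈ polynomialsIn U g) :
    (fun z => a * F z) ∈ polynomialsIn U g :=
  polynomialsIn_mul (polynomialsIn_const a) hF

theorem polynomialsIn_sub (hF : F ∈ polynomialsIn U g) (hG : G ∈ polynomialsIn U g) :
    (fun z => F z - G z) ∈ polynomialsIn U g :=
  polynomialsIn_congr (polynomialsIn_add hF (polynomialsIn_const_mul (-1) hG))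
    fun z _ => by simp [sub_eq_add_neg]

theorem polynomialsIn_pow (hF : F ∈ polynomialsIn U g) (k : ℕ) :
    (fun z => F z ^ k) ∈ polynomialsIn U g := by
  obtain ⟨Φ, hΦ⟩ := hF
  exact ⟨Φ ^ k, fun z hz => by simp [hΦ z hz]⟩

/-- A polynomial evaluated at differentiable functions is differentiable. -/
theorem differentiableAt_eval {z : PhaseSpace 𝕜 n} (hg : ∀ i, DifferentiableAt 𝕜 (g i) z)
    (Φ : MvPolynomial (Fin N) 𝕜) :
    DifferentiableAt 𝕜 (fun w => Φ.eval (fun i => g i w)) z := by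
  induction Φ using MvPolynomial.induction_on with
  | C a => simp
  | add p q hp hq =>
    simp only [map_add]
    exact hp.fun_add hq
  | mul_X p i hp =>
    simp only [map_mul, MvPolynomial.eval_X]
    exact hp.fun_mul (hg i)

/-- The bracket with `E` is a derivation, so its values on the generators determine it on all
polynomials. -/
theorem poisson_eval_mem {E : PhaseSpace 𝕜 n → 𝕜}
    (hg : ∀ i, ∀ z ∈ U, DifferentiableAt 𝕜 (g i) z)
    (h : ∀ i, poisson E (g i) ∈ polynomialsIn U g) (Φ : MvPolynomial (Fin N) 𝕜) :
    poisson E (fun w => Φ.eval (fun i => g i w)) ∈ polynomialsIn U g := by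
  induction Φ using MvPolynomial.induction_on with
  | C a => exact ⟨0, fun z _ => by simp [poisson_const]⟩
  | add p q hp hq =>
    refine polynomialsIn_congr (polynomialsIn_add hp hq) fun z hz => ?_
    simp only [map_add]
    exact (poisson_add (differentiableAt_eval (fun i => hg i z hz) p)
      (differentiableAt_eval (fun i => hg i z hz) q)).symm
  | mul_X p i hp =>
    refine polynomialsIn_congr (polynomialsIn_add (polynomialsIn_mul ⟨p, fun _ _ => rfl⟩ (h i))
      (polynomialsIn_mul (polynomialsIn_gen i) hp)) fun z hz => ?_
    simp only [map_mul, MvPolynomial.eval_X]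
    exact (poisson_mul (differentiableAt_eval (fun i => hg i z hz) p) (hg i z hz)).symm

/-- If the brackets of the `g i` are polynomials in `g`, then so is every element of the symmetry
algebra generated by polynomials in `g`. -/
theorem consistsOfPolynomialsIn_symmetryAlgebra (hU : IsOpen U)
    (hg : ∀ i, ∀ z ∈ U, DifferentiableAt 𝕜 (g i) z)
    (h : ∀ i j, poisson (g i) (g j) ∈ polynomialsIn U g) {S : Set (PhaseSpace 𝕜 n → 𝕜)}
    (hS : S ⊆ polynomialsIn U g) : ConsistsOfPolynomialsIn U (symmetryAlgebra U S) g := by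
  intro F hF
  change F ∈ polynomialsIn U g
  induction hF with
  | generator hF => exact hS hF
  | smul a _ ih => exact polynomialsIn_const_mul a ih
  | sum _ _ ihF ihG => exact polynomialsIn_add ihF ihG
  | prod _ _ ihF ihG => exact polynomialsIn_mul ihF ihG
  | congr _ hFG ih => exact polynomialsIn_congr ih hFG
  | @bracket F G _ _ ihF ihG =>
    obtain ⟨Φ, hΦ⟩ := ihF
    obtain ⟨Ψ, hΨ⟩ := ihG
    have h1 (i : Fin N) : poisson (g i) F ∈ polynomialsIn U g :=
      polynomialsIn_congr (poisson_eval_mem hg (h i) Φ) fun z hz =>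
        poisson_congr hU (Set.eqOn_refl _ _) (fun w hw => (hΦ w hw).symm) hz
    have h2 (i : Fin N) : poisson F (g i) ∈ polynomialsIn U g :=
      polynomialsIn_congr (polynomialsIn_const_mul (-1) (h1 i)) fun z _ => by
        rw [poisson_antisymm F]; ring
    exact polynomialsIn_congr (poisson_eval_mem hg h2 Ψ) fun z hz =>
      poisson_congr hU (Set.eqOn_refl _ _) (fun w hw => (hΨ w hw).symm) hz

theorem symmetryAlgebra_subset {S T : Set (PhaseSpace 𝕜 n → 𝕜)} (h : S ⊆ symmetryAlgebra U T) :
    symmetryAlgebra U S ⊆ symmetryAlgebra U T := by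
  intro F hF
  induction hF with
  | generator hF => exact h hF
  | smul a _ ih => exact .smul a ih
  | sum _ _ ihF ihG => exact .sum ihF ihG
  | prod _ _ ihF ihG => exact .prod ihF ihG
  | bracket _ _ ihF ihG => exact .bracket ihF ihG
  | congr _ hFG ih => exact .congr ih hFG

/-- Only positive exponents: the algebra is not assumed to contain the constants. -/
theorem InSymmetryAlgebra.pow_succ {S : Set (PhaseSpace 𝕜 n → 𝕜)} (hF : InSymmetryAlgebra U S F)
    (k : ℕ) : InSymmetryAlgebra U S (fun z => F z ^ (k + 1)) := by
  induction k with
  | zero => simpa using hF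
  | succ k ih => exact (ih.prod hF).congr fun z _ => (_root_.pow_succ (F z) (k + 1)).symm

end SymmetryAlgebra

/-! ### Brackets of the TTW Hamiltonian and of its second order constant of the motion -/

section TTW

variable {𝕜 : Type*} [RCLike 𝕜] {k α β ω : 𝕜} {z : PhaseSpace 𝕜 2}

theorem isOpen_ttwDomain (k : 𝕜) : IsOpen (ttwDomain k) := by
  have hs : Continuous (sinK : 𝕜 → 𝕜) :=
    continuous_iff_continuousAt.mpr fun x => (analyticAt_sinK x).continuousAt
  have hc : Continuous (cosK : 𝕜 → 𝕜) :=
    continuous_iff_continuousAt.mpr fun x => (analyticAt_cosK x).continuousAt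
  refine (isOpen_ne_fun (by fun_prop) continuous_const).inter
    ((isOpen_ne_fun ?_ continuous_const).inter (isOpen_ne_fun ?_ continuous_const)) <;> fun_prop

theorem analyticAt_position (i : Fin 2) (x : Fin 2 → 𝕜) :
    AnalyticAt 𝕜 (fun x : Fin 2 → 𝕜 => x i) x :=
  (ContinuousLinearMap.proj (R := 𝕜) (φ := fun _ : Fin 2 => 𝕜) i).analyticAt x

theorem analyticAt_sinK_position (c : 𝕜) (i : Fin 2) (x : Fin 2 → 𝕜) :
    AnalyticAt 𝕜 (fun x : Fin 2 → 𝕜 => sinK (c * x i)) x :=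
  (analyticAt_sinK (c * x i)).fun_comp (g := sinK) (f := fun x : Fin 2 → 𝕜 => c * x i)
    (analyticAt_const.mul (analyticAt_position i x))

theorem analyticAt_cosK_position (c : 𝕜) (i : Fin 2) (x : Fin 2 → 𝕜) :
    AnalyticAt 𝕜 (fun x : Fin 2 → 𝕜 => cosK (c * x i)) x :=
  (analyticAt_cosK (c * x i)).fun_comp (g := cosK) (f := fun x : Fin 2 → 𝕜 => c * x i)
    (analyticAt_const.mul (analyticAt_position i x))

theorem analyticOnNhd_ttw_potential (k α β : 𝕜) :
    AnalyticOnNhd 𝕜 (fun x : Fin 2 → 𝕜 => α / cosK (k * x 1) ^ 2 + β / sinK (k * x 1) ^ 2)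
      (ttwDomain k) := fun x hx =>
  (analyticAt_const.div ((analyticAt_cosK_position k 1 x).pow 2) (pow_ne_zero 2 hx.2.2)).add
    (analyticAt_const.div ((analyticAt_sinK_position k 1 x).pow 2) (pow_ne_zero 2 hx.2.1))

theorem analyticOnNhd_inv_radius_sq (k a : 𝕜) :
    AnalyticOnNhd 𝕜 (fun x : Fin 2 → 𝕜 => a / x 0 ^ 2) (ttwDomain k) := fun x hx =>
  analyticAt_const.div ((analyticAt_position 0 x).pow 2) (pow_ne_zero 2 hx.1)

theorem hasMomentumLead_ttwL2 (k α β : 𝕜) :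
    HasMomentumLead (ttwDomain k) 1 (ttwL2 k α β) 2 (fun _ => 1) := by
  have h := ((HasMomentumLead.momentum (D := ttwDomain k) (i := 1) (1 : Fin 2)).pow 2).add
    ((HasMomentumLead.of_position (i := 1) (analyticOnNhd_ttw_potential k α β)).of_lt
      (by norm_num : 0 < 1 * 2))
  exact h.congr (fun z _ => by simp only [ttwL2]; ring) (fun x _ => by simp)

theorem ttwH_eq (k α β ω : 𝕜) (z : PhaseSpace 𝕜 2) :
    ttwH k α β ω z = z.2 0 ^ 2 + 1 / z.1 0 ^ 2 * ttwL2 k α β z + ω ^ 2 * z.1 0 ^ 2 := by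
  simp only [ttwH, ttwL2]; ring

theorem hasMomentumLead_ttwH (k α β ω : 𝕜) :
    HasMomentumLead (ttwDomain k) 1 (ttwH k α β ω) 2 (fun x => 1 / x 0 ^ 2) := by
  have h1 := (HasMomentumLead.momentum (D := ttwDomain k) (i := 1) (0 : Fin 2)).pow 2
  have h2 := (HasMomentumLead.of_position (i := 1) (analyticOnNhd_inv_radius_sq k 1)).mul
    (hasMomentumLead_ttwL2 k α β)
  have h3 := (HasMomentumLead.of_position (D := ttwDomain k) (i := 1)
    (f := fun x : Fin 2 → 𝕜 => ω ^ 2 * x 0 ^ 2)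
    (fun x _ => analyticAt_const.mul ((analyticAt_position 0 x).pow 2))).of_lt
      (by norm_num : 0 < 0 + 2)
  exact ((h1.add h2).add h3).congr (fun z _ => (ttwH_eq k α β ω z).symm) (fun x _ => by simp)

theorem differentiableAt_of_lead {F : PhaseSpace 𝕜 2 → 𝕜} {N : ℕ} {f : (Fin 2 → 𝕜) → 𝕜}
    (h : HasMomentumLead (ttwDomain k) 1 F N f) (hz : z ∈ phaseOver (ttwDomain k)) :
    DifferentiableAt 𝕜 F z :=
  (h.analyticOnNhd (isOpen_ttwDomain k) z hz).differentiableAt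

theorem differentiableAt_position (i : Fin 2) :
    DifferentiableAt 𝕜 (fun w : PhaseSpace 𝕜 2 => w.1 i) z := by fun_prop

theorem differentiableAt_momentum (i : Fin 2) :
    DifferentiableAt 𝕜 (fun w : PhaseSpace 𝕜 2 => w.2 i) z := by fun_prop

theorem differentiableAt_comp_position {φ : 𝕜 → 𝕜} {φ' : 𝕜} (i : Fin 2)
    (h : HasDerivAt φ φ' (z.1 i)) :
    DifferentiableAt 𝕜 (fun w : PhaseSpace 𝕜 2 => φ (w.1 i)) z :=
  (h.comp_hasFDerivAt (f := fun w : PhaseSpace 𝕜 2 => w.1 i) z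
    (differentiableAt_position i).hasFDerivAt).differentiableAt

theorem hasDerivAt_sinK_mul (c x : 𝕜) :
    HasDerivAt (fun y => sinK (c * y)) (cosK (c * x) * c) x := by
  have h1 : HasDerivAt (fun y => c * y) c x := by simpa using (hasDerivAt_id x).const_mul c
  exact (hasDerivAt_sinK (c * x)).comp x h1

theorem hasDerivAt_cosK_mul (c x : 𝕜) :
    HasDerivAt (fun y => cosK (c * y)) (-sinK (c * x) * c) x := by
  have h1 : HasDerivAt (fun y => c * y) c x := by simpa using (hasDerivAt_id x).const_mul c
  exact (hasDerivAt_cosK (c * x)).comp x h1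

theorem hasDerivAt_ttw_potential {x : 𝕜} (hs : sinK (k * x) ≠ 0) (hc : cosK (k * x) ≠ 0) :
    HasDerivAt (fun y => α / cosK (k * y) ^ 2 + β / sinK (k * y) ^ 2)
      (2 * k * α * sinK (k * x) / cosK (k * x) ^ 3 - 2 * k * β * cosK (k * x) / sinK (k * x) ^ 3)
      x := by
  have h1 := (hasDerivAt_const x α).fun_div ((hasDerivAt_cosK_mul k x).fun_pow 2)
    (pow_ne_zero 2 hc)
  have h2 := (hasDerivAt_const x β).fun_div ((hasDerivAt_sinK_mul k x).fun_pow 2)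
    (pow_ne_zero 2 hs)
  refine (h1.fun_add h2).congr_deriv ?_
  field_simp
  ring

/-- The chain rule with an arbitrary left entry: it reduces brackets with L₂ to brackets with the
coordinates, whatever `E` is. -/
theorem poisson_ttwL2 (E : PhaseSpace 𝕜 2 → 𝕜) (hz : z ∈ phaseOver (ttwDomain k)) :
    poisson E (ttwL2 k α β) z = 2 * z.2 1 * poisson E (fun w => w.2 1) z +
      (2 * k * α * sinK (k * z.1 1) / cosK (k * z.1 1) ^ 3 -
        2 * k * β * cosK (k * z.1 1) / sinK (k * z.1 1) ^ 3) * poisson E (fun w => w.1 1) z := by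
  have hV := hasDerivAt_ttw_potential (α := α) (β := β) hz.2.1 hz.2.2
  have hd : DifferentiableAt 𝕜 (fun w : PhaseSpace 𝕜 2 =>
      α / cosK (k * w.1 1) ^ 2 + β / sinK (k * w.1 1) ^ 2) z :=
    differentiableAt_comp_position 1 hV
  have h := poisson_add (H := E) ((differentiableAt_momentum (z := z) 1).fun_pow 2) hd
  rw [poisson_pow (differentiableAt_momentum 1), poisson_comp (F := fun w => w.1 1) hV
    (differentiableAt_position 1)] at h
  have h2 : ttwL2 k α β = fun w => w.2 1 ^ 2 +
      (α / cosK (k * w.1 1) ^ 2 + β / sinK (k * w.1 1) ^ 2) := by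
    funext w; simp only [ttwL2]; ring
  rw [h2, h]
  norm_num

theorem hasDerivAt_inv_sq {x : 𝕜} (hx : x ≠ 0) (a : 𝕜) :
    HasDerivAt (fun y => a / y ^ 2) (-2 * a / x ^ 3) x := by
  refine ((hasDerivAt_const x a).fun_div ((hasDerivAt_id x).fun_pow 2)
    (pow_ne_zero 2 hx)).congr_deriv ?_
  simp only [id]
  field_simp
  ring

theorem poisson_inv_radius_sq (E : PhaseSpace 𝕜 2 → 𝕜) (hz : z ∈ phaseOver (ttwDomain k))
    (a : 𝕜) : poisson E (fun w => a / w.1 0 ^ 2) z =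
      -2 * a / z.1 0 ^ 3 * poisson E (fun w => w.1 0) z :=
  poisson_comp (F := fun w => w.1 0) (hasDerivAt_inv_sq hz.1 a) (differentiableAt_position 0)

theorem differentiableAt_inv_radius_sq (hz : z ∈ phaseOver (ttwDomain k)) (a : 𝕜) :
    DifferentiableAt 𝕜 (fun w : PhaseSpace 𝕜 2 => a / w.1 0 ^ 2) z :=
  differentiableAt_of_lead (.of_position (analyticOnNhd_inv_radius_sq k a)) hz

theorem poisson_ttwH (E : PhaseSpace 𝕜 2 → 𝕜) (hz : z ∈ phaseOver (ttwDomain k)) :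
    poisson E (ttwH k α β ω) z = 2 * z.2 0 * poisson E (fun w => w.2 0) z +
      1 / z.1 0 ^ 2 * poisson E (ttwL2 k α β) z +
      (2 * ω ^ 2 * z.1 0 - 2 * ttwL2 k α β z / z.1 0 ^ 3) * poisson E (fun w => w.1 0) z := by
  have hL := differentiableAt_of_lead (hasMomentumLead_ttwL2 k α β) hz
  have hr := differentiableAt_inv_radius_sq hz 1
  have h1 := (differentiableAt_momentum (z := z) 0).fun_pow 2
  have h2 := hr.fun_mul hL
  have h3 := (differentiableAt_position (z := z) 0).fun_pow 2
  rw [show ttwH k α β ω = _ from funext (ttwH_eq k α β ω),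
    poisson_add (h1.fun_add h2) (h3.const_mul _), poisson_add h1 h2,
    poisson_pow (differentiableAt_momentum 0), poisson_mul hr hL, poisson_const_mul _ h3,
    poisson_pow (differentiableAt_position 0), poisson_inv_radius_sq E hz]
  push_cast
  ring

@[simp] theorem poisson_position_position (i j : Fin 2) :
    poisson (fun w : PhaseSpace 𝕜 2 => w.1 i) (fun w => w.1 j) z = 0 := by
  rw [poisson_position]; simp [partialMom, fderiv_position]

@[simp] theorem poisson_momentum_position (i j : Fin 2) :
    poisson (fun w : PhaseSpace 𝕜 2 => w.2 i) (fun w => w.1 j) z = if i = j then 1 else 0 := by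
  rw [poisson_position]; simp [partialMom, fderiv_momentum, Pi.single_apply]

@[simp] theorem poisson_position_momentum (i j : Fin 2) :
    poisson (fun w : PhaseSpace 𝕜 2 => w.1 i) (fun w => w.2 j) z = if i = j then -1 else 0 := by
  rw [poisson_momentum]; simp [partialPos, fderiv_position, Pi.single_apply, neg_ite]

@[simp] theorem poisson_momentum_momentum (i j : Fin 2) :
    poisson (fun w : PhaseSpace 𝕜 2 => w.2 i) (fun w => w.2 j) z = 0 := by
  rw [poisson_momentum]; simp [partialPos, fderiv_momentum]

/-! ### Brackets of L₂ and H with the coordinates and with each other -/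

theorem poisson_ttwL2_radius (hz : z ∈ phaseOver (ttwDomain k)) :
    poisson (ttwL2 k α β) (fun w => w.1 0) z = 0 := by
  rw [poisson_antisymm, poisson_ttwL2 _ hz]; simp

theorem poisson_ttwL2_angle (hz : z ∈ phaseOver (ttwDomain k)) :
    poisson (ttwL2 k α β) (fun w => w.1 1) z = 2 * z.2 1 := by
  rw [poisson_antisymm, poisson_ttwL2 _ hz]; simp

theorem poisson_ttwL2_momentum_zero (hz : z ∈ phaseOver (ttwDomain k)) :
    poisson (ttwL2 k α β) (fun w => w.2 0) z = 0 := by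
  rw [poisson_antisymm, poisson_ttwL2 _ hz]; simp

theorem poisson_ttwL2_momentum_one (hz : z ∈ phaseOver (ttwDomain k)) :
    poisson (ttwL2 k α β) (fun w => w.2 1) z =
      2 * k * β * cosK (k * z.1 1) / sinK (k * z.1 1) ^ 3 -
        2 * k * α * sinK (k * z.1 1) / cosK (k * z.1 1) ^ 3 := by
  rw [poisson_antisymm, poisson_ttwL2 _ hz]; simp

theorem poisson_ttwL2_ttwH (hz : z ∈ phaseOver (ttwDomain k)) :
    poisson (ttwL2 k α β) (ttwH k α β ω) z = 0 := by
  rw [poisson_ttwH _ hz, poisson_self, poisson_ttwL2_radius hz, poisson_ttwL2_momentum_zero hz]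
  ring

theorem poisson_ttwH_ttwL2 (hz : z ∈ phaseOver (ttwDomain k)) :
    poisson (ttwH k α β ω) (ttwL2 k α β) z = 0 := by
  rw [poisson_antisymm, poisson_ttwL2_ttwH hz, neg_zero]

theorem poisson_ttwH_radius (hz : z ∈ phaseOver (ttwDomain k)) :
    poisson (ttwH k α β ω) (fun w => w.1 0) z = 2 * z.2 0 := by
  rw [poisson_antisymm, poisson_ttwH _ hz, poisson_ttwL2 _ hz]; simp

/-- H depends on the angular variables through L₂/r² only, so the angular part of its flow is that
of L₂ slowed down by r². -/
theorem poisson_ttwH_angle (hz : z ∈ phaseOver (ttwDomain k)) :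
    poisson (ttwH k α β ω) (fun w => w.1 1) z =
      1 / z.1 0 ^ 2 * poisson (ttwL2 k α β) (fun w => w.1 1) z := by
  rw [poisson_antisymm, poisson_ttwH _ hz, poisson_antisymm (ttwL2 k α β)]; simp

theorem poisson_ttwH_momentum_zero (hz : z ∈ phaseOver (ttwDomain k)) :
    poisson (ttwH k α β ω) (fun w => w.2 0) z =
      2 * ttwL2 k α β z / z.1 0 ^ 3 - 2 * ω ^ 2 * z.1 0 := by
  rw [poisson_antisymm, poisson_ttwH _ hz, poisson_ttwL2 _ hz]; simp

theorem poisson_ttwH_momentum_one (hz : z ∈ phaseOver (ttwDomain k)) :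
    poisson (ttwH k α β ω) (fun w => w.2 1) z =
      1 / z.1 0 ^ 2 * poisson (ttwL2 k α β) (fun w => w.2 1) z := by
  rw [poisson_antisymm, poisson_ttwH _ hz, poisson_antisymm (ttwL2 k α β)]; simp

/-! ### The real and imaginary parts of `X` and `Y` -/

/-- `X = s * ttwXcoeff + i * ttwXfree`. -/
def ttwXcoeff (k : 𝕜) (z : PhaseSpace 𝕜 2) : 𝕜 := sinK (2 * k * z.1 1) * z.2 1

/-- `X = s * ttwXcoeff + i * ttwXfree`. -/
def ttwXfree (k α β : 𝕜) (z : PhaseSpace 𝕜 2) : 𝕜 :=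
  -β + α - ttwL2 k α β z * cosK (2 * k * z.1 1)

/-- `Y = s * ttwYcoeff + i * ttwYfree`. -/
def ttwYcoeff (z : PhaseSpace 𝕜 2) : 𝕜 := 2 * (z.2 0 / z.1 0)

/-- `Y = s * ttwYcoeff + i * ttwYfree`. -/
def ttwYfree (k α β ω : 𝕜) (z : PhaseSpace 𝕜 2) : 𝕜 :=
  2 * ttwL2 k α β z / z.1 0 ^ 2 - ttwH k α β ω z

theorem hasMomentumLead_ttwXcoeff (k : 𝕜) :
    HasMomentumLead (ttwDomain k) 1 (ttwXcoeff k) 1 (fun x => sinK (2 * k * x 1)) :=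
  ((HasMomentumLead.of_position (i := 1)
    (fun x _ => analyticAt_sinK_position (2 * k) 1 x)).mul (.momentum 1)).congr
    (fun _ _ => rfl) (fun x _ => by simp)

theorem hasMomentumLead_ttwXfree (k α β : 𝕜) :
    HasMomentumLead (ttwDomain k) 1 (ttwXfree k α β) 2 (fun x => -cosK (2 * k * x 1)) :=
  (((HasMomentumLead.const (-β + α)).of_lt zero_lt_two).sub
    ((hasMomentumLead_ttwL2 k α β).mul
      (.of_position fun x _ => analyticAt_cosK_position (2 * k) 1 x))).congr
    (fun _ _ => rfl) (fun x _ => by simp)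

theorem hasMomentumLead_ttwYcoeff (k : 𝕜) :
    HasMomentumLead (ttwDomain k) 1 ttwYcoeff 1 (fun _ => 0) :=
  ((HasMomentumLead.of_position (D := ttwDomain k) (i := 1) (f := fun x : Fin 2 → 𝕜 => 2 / x 0)
    (fun x hx => analyticAt_const.div (analyticAt_position 0 x) hx.1)).mul (.momentum 0)).congr
    (fun z _ => by simp only [ttwYcoeff]; ring) (fun x _ => by simp)

theorem hasMomentumLead_ttwYfree (k α β ω : 𝕜) :
    HasMomentumLead (ttwDomain k) 1 (ttwYfree k α β ω) 2 (fun x => 1 / x 0 ^ 2) :=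
  (((HasMomentumLead.of_position (i := 1) (analyticOnNhd_inv_radius_sq k 2)).mul
    (hasMomentumLead_ttwL2 k α β)).sub (hasMomentumLead_ttwH k α β ω)).congr
    (fun z _ => by simp only [ttwYfree]; ring) (fun x _ => by ring)

theorem poisson_ttwXcoeff (E : PhaseSpace 𝕜 2 → 𝕜) :
    poisson E (ttwXcoeff k) z =
      2 * k * cosK (2 * k * z.1 1) * z.2 1 * poisson E (fun w => w.1 1) z +
        sinK (2 * k * z.1 1) * poisson E (fun w => w.2 1) z := by
  have h := hasDerivAt_sinK_mul (2 * k) (z.1 1)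
  have hd : DifferentiableAt 𝕜 (fun w : PhaseSpace 𝕜 2 => sinK (2 * k * w.1 1)) z :=
    differentiableAt_comp_position 1 h
  have h2 := poisson_mul (H := E) hd (differentiableAt_momentum (z := z) 1)
  rw [poisson_comp (F := fun w => w.1 1) h (differentiableAt_position 1)] at h2
  rw [show ttwXcoeff k = fun w => sinK (2 * k * w.1 1) * w.2 1 from rfl, h2]
  ring

theorem poisson_ttwXfree (E : PhaseSpace 𝕜 2 → 𝕜) (hz : z ∈ phaseOver (ttwDomain k)) :
    poisson E (ttwXfree k α β) z =
      2 * k * sinK (2 * k * z.1 1) * ttwL2 k α β z * poisson E (fun w => w.1 1) z -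
        cosK (2 * k * z.1 1) * poisson E (ttwL2 k α β) z := by
  have h := hasDerivAt_cosK_mul (2 * k) (z.1 1)
  have hd : DifferentiableAt 𝕜 (fun w : PhaseSpace 𝕜 2 => cosK (2 * k * w.1 1)) z :=
    differentiableAt_comp_position 1 h
  have hL := differentiableAt_of_lead (hasMomentumLead_ttwL2 k α β) hz
  have h2 := poisson_mul (H := E) hL hd
  rw [poisson_comp (F := fun w => w.1 1) h (differentiableAt_position 1)] at h2
  rw [show ttwXfree k α β = fun w => (-β + α) - ttwL2 k α β w * cosK (2 * k * w.1 1) from rfl,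
    poisson_sub (differentiableAt_const _) (hL.fun_mul hd), poisson_const, h2]
  ring

theorem poisson_ttwYcoeff (E : PhaseSpace 𝕜 2 → 𝕜) (hz : z ∈ phaseOver (ttwDomain k)) :
    poisson E ttwYcoeff z = 2 / z.1 0 * poisson E (fun w => w.2 0) z -
      2 * z.2 0 / z.1 0 ^ 2 * poisson E (fun w => w.1 0) z := by
  have h : HasDerivAt (fun y : 𝕜 => 2 / y) (-2 / z.1 0 ^ 2) (z.1 0) := by
    exact ((hasDerivAt_const (z.1 0) (2 : 𝕜)).fun_div (hasDerivAt_id (z.1 0)) hz.1).congr_deriv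
      (by simp)
  have hd : DifferentiableAt 𝕜 (fun w : PhaseSpace 𝕜 2 => 2 / w.1 0) z :=
    differentiableAt_comp_position 0 h
  have h2 := poisson_mul (H := E) hd (differentiableAt_momentum (z := z) 0)
  rw [poisson_comp (F := fun w => w.1 0) h (differentiableAt_position 0)] at h2
  rw [show ttwYcoeff = fun w : PhaseSpace 𝕜 2 => 2 / w.1 0 * w.2 0 from
    funext fun w => by simp only [ttwYcoeff]; ring, h2]
  ring

theorem poisson_ttwYfree (E : PhaseSpace 𝕜 2 → 𝕜) (hz : z ∈ phaseOver (ttwDomain k)) :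
    poisson E (ttwYfree k α β ω) z = 2 / z.1 0 ^ 2 * poisson E (ttwL2 k α β) z -
      4 * ttwL2 k α β z / z.1 0 ^ 3 * poisson E (fun w => w.1 0) z -
      poisson E (ttwH k α β ω) z := by
  have hL := differentiableAt_of_lead (hasMomentumLead_ttwL2 k α β) hz
  have hH := differentiableAt_of_lead (hasMomentumLead_ttwH k α β ω) hz
  have hr := differentiableAt_inv_radius_sq hz 2
  rw [show ttwYfree k α β ω = fun w => 2 / w.1 0 ^ 2 * ttwL2 k α β w - ttwH k α β ω w from
    funext fun w => by simp only [ttwYfree]; ring, poisson_sub (hr.fun_mul hL) hH,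
    poisson_mul hr hL, poisson_inv_radius_sq E hz]
  ring

theorem poisson_ttwL2_ttwXcoeff (hz : z ∈ phaseOver (ttwDomain k)) :
    poisson (ttwL2 k α β) (ttwXcoeff k) z = -(4 * k) * ttwXfree k α β z := by
  have hs := hz.2.1
  have hc := hz.2.2
  rw [poisson_ttwXcoeff, poisson_ttwL2_angle hz, poisson_ttwL2_momentum_one hz, ttwXfree, ttwL2,
    mul_assoc 2 k (z.1 1), sinK_two_mul, cosK_two_mul]
  field_simp
  ring

theorem poisson_ttwL2_ttwXfree (hz : z ∈ phaseOver (ttwDomain k)) :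
    poisson (ttwL2 k α β) (ttwXfree k α β) z = 4 * k * ttwL2 k α β z * ttwXcoeff k z := by
  rw [poisson_ttwXfree _ hz, poisson_ttwL2_angle hz, poisson_self, ttwXcoeff]
  ring

theorem poisson_ttwL2_ttwYcoeff (hz : z ∈ phaseOver (ttwDomain k)) :
    poisson (ttwL2 k α β) ttwYcoeff z = 0 := by
  rw [poisson_ttwYcoeff _ hz, poisson_ttwL2_momentum_zero hz, poisson_ttwL2_radius hz]
  ring

theorem poisson_ttwL2_ttwYfree (hz : z ∈ phaseOver (ttwDomain k)) :
    poisson (ttwL2 k α β) (ttwYfree k α β ω) z = 0 := by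
  rw [poisson_ttwYfree _ hz, poisson_self, poisson_ttwL2_radius hz, poisson_ttwL2_ttwH hz]
  ring

theorem poisson_ttwH_ttwXcoeff (hz : z ∈ phaseOver (ttwDomain k)) :
    poisson (ttwH k α β ω) (ttwXcoeff k) z =
      -(4 * k / z.1 0 ^ 2) * ttwXfree k α β z := by
  have h := poisson_ttwL2_ttwXcoeff (α := α) (β := β) hz
  rw [poisson_ttwXcoeff] at h ⊢
  rw [poisson_ttwH_angle hz, poisson_ttwH_momentum_one hz]
  linear_combination 1 / z.1 0 ^ 2 * h

theorem poisson_ttwH_ttwXfree (hz : z ∈ phaseOver (ttwDomain k)) :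
    poisson (ttwH k α β ω) (ttwXfree k α β) z =
      4 * k / z.1 0 ^ 2 * ttwL2 k α β z * ttwXcoeff k z := by
  rw [poisson_ttwXfree _ hz, poisson_ttwH_angle hz, poisson_ttwL2_angle hz,
    poisson_ttwH_ttwL2 hz, ttwXcoeff]
  ring

theorem poisson_ttwH_ttwYcoeff (hz : z ∈ phaseOver (ttwDomain k)) :
    poisson (ttwH k α β ω) ttwYcoeff z = 4 / z.1 0 ^ 2 * ttwYfree k α β ω z := by
  have hr := hz.1
  rw [poisson_ttwYcoeff _ hz, poisson_ttwH_momentum_zero hz, poisson_ttwH_radius hz, ttwYfree,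
    ttwH_eq]
  field_simp
  ring

theorem poisson_ttwH_ttwYfree (hz : z ∈ phaseOver (ttwDomain k)) :
    poisson (ttwH k α β ω) (ttwYfree k α β ω) z =
      -(4 / z.1 0 ^ 2) * ttwL2 k α β z * ttwYcoeff z := by
  have hr := hz.1
  rw [poisson_ttwYfree _ hz, poisson_ttwH_ttwL2 hz, poisson_self, poisson_ttwH_radius hz,
    ttwYcoeff]
  field_simp
  ring

theorem ttwXfree_sq_add (hz : z ∈ phaseOver (ttwDomain k)) :
    ttwXfree k α β z ^ 2 + ttwL2 k α β z * ttwXcoeff k z ^ 2 =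
      (ttwL2 k α β z - α - β) ^ 2 - 4 * α * β := by
  have hs := hz.2.1
  have hc := hz.2.2
  have hp := sinK_sq_add_cosK_sq (k * z.1 1)
  -- Here p_θ² is eliminated in favour of L₂, and the factor sin² cos² clears the denominators of
  -- the potential. What remains is an identity modulo sin² + cos² = 1.
  have ha : ttwXcoeff k z ^ 2 = 4 * sinK (k * z.1 1) ^ 2 * cosK (k * z.1 1) ^ 2 * ttwL2 k α β z -
      4 * sinK (k * z.1 1) ^ 2 * α - 4 * cosK (k * z.1 1) ^ 2 * β := by
    rw [ttwXcoeff, ttwL2, mul_assoc 2 k (z.1 1), sinK_two_mul]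
    field_simp
    ring
  rw [ha, ttwXfree, mul_assoc 2 k (z.1 1), cosK_two_mul]
  generalize ttwL2 k α β z = l
  generalize sinK (k * z.1 1) = s at *
  generalize cosK (k * z.1 1) = c at *
  linear_combination (l ^ 2 * (s ^ 2 + c ^ 2 + 1) - 2 * l * α - 2 * l * β) * hp

theorem ttwYfree_sq_add (hz : z ∈ phaseOver (ttwDomain k)) :
    ttwYfree k α β ω z ^ 2 + ttwL2 k α β z * ttwYcoeff z ^ 2 =
      ttwH k α β ω z ^ 2 - 4 * ω ^ 2 * ttwL2 k α β z := by
  have hr := hz.1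
  rw [ttwYfree, ttwYcoeff, ttwH_eq]
  field_simp
  ring

/-! ### The product `(b + t a)^q (d + t c)^p` with `t ^ 2 = -L₂` -/

/-- The functions `A + t B` on phase space, where `t ^ 2 = -L₂`. -/
abbrev TTWAlgebra (k α β : 𝕜) : Type _ :=
  QuadraticAlgebra (PhaseSpace 𝕜 2 → 𝕜) (-ttwL2 k α β) 0

/-- `X / i` with `t = -i √L₂`. -/
def ttwXElement (k α β : 𝕜) : TTWAlgebra k α β := ⟨ttwXfree k α β, ttwXcoeff k⟩

/-- `Y / i` with `t = -i √L₂`. -/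
def ttwYElement (k α β ω : 𝕜) : TTWAlgebra k α β := ⟨ttwYfree k α β ω, ttwYcoeff⟩

/-- `L⁺ / i ^ (p + q)` with `t = -i √L₂`. -/
def ttwProduct (p q : ℕ) (k α β ω : 𝕜) : TTWAlgebra k α β :=
  ttwXElement k α β ^ q * ttwYElement k α β ω ^ p

theorem TTWAlgebra.re_mul (Z W : TTWAlgebra k α β) (z : PhaseSpace 𝕜 2) :
    (Z * W).re z = Z.re z * W.re z - ttwL2 k α β z * (Z.im z * W.im z) := by
  simp [QuadraticAlgebra.re_mul]; ring

theorem TTWAlgebra.im_mul (Z W : TTWAlgebra k α β) (z : PhaseSpace 𝕜 2) :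
    (Z * W).im z = Z.re z * W.im z + Z.im z * W.re z := by
  simp [QuadraticAlgebra.im_mul]

/-- The value at a point, for a choice of a square root of `-L₂`. -/
def TTWAlgebra.value (t : ℂ) (Z : TTWAlgebra k α β) (z : PhaseSpace 𝕜 2) : ℂ :=
  toCx (Z.re z) + t * toCx (Z.im z)

theorem TTWAlgebra.value_mul {t : ℂ} (ht : t ^ 2 = -toCx (ttwL2 k α β z))
    (Z W : TTWAlgebra k α β) : (Z * W).value t z = Z.value t z * W.value t z := by
  simp only [TTWAlgebra.value, TTWAlgebra.re_mul, TTWAlgebra.im_mul, toCx_add, toCx_sub, toCx_mul]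
  linear_combination (-toCx (Z.im z) * toCx (W.im z)) * ht

theorem TTWAlgebra.value_pow {t : ℂ} (ht : t ^ 2 = -toCx (ttwL2 k α β z))
    (Z : TTWAlgebra k α β) (n : ℕ) : (Z ^ n).value t z = Z.value t z ^ n := by
  induction n with
  | zero => simp [TTWAlgebra.value, toCx_one, toCx_zero, QuadraticAlgebra.re_one,
      QuadraticAlgebra.im_one]
  | succ n ih => rw [pow_succ, TTWAlgebra.value_mul ht, ih, pow_succ]

/-- The norm `A ^ 2 + L₂ B ^ 2` of `A + t B`. -/
def TTWAlgebra.normAt (Z : TTWAlgebra k α β) (z : PhaseSpace 𝕜 2) : 𝕜 :=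
  Z.re z ^ 2 + ttwL2 k α β z * Z.im z ^ 2

theorem TTWAlgebra.normAt_mul (Z W : TTWAlgebra k α β) :
    (Z * W).normAt z = Z.normAt z * W.normAt z := by
  simp only [TTWAlgebra.normAt, TTWAlgebra.re_mul, TTWAlgebra.im_mul]
  ring

theorem TTWAlgebra.normAt_pow (Z : TTWAlgebra k α β) (n : ℕ) :
    (Z ^ n).normAt z = Z.normAt z ^ n := by
  induction n with
  | zero => simp [TTWAlgebra.normAt, QuadraticAlgebra.re_one, QuadraticAlgebra.im_one]
  | succ n ih => rw [pow_succ, TTWAlgebra.normAt_mul, ih, pow_succ]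

/-- The norm is multiplicative, and the norms of the two factors are the two bases in P. -/
theorem normAt_ttwProduct (p q : ℕ) (hz : z ∈ phaseOver (ttwDomain k)) :
    (ttwProduct p q k α β ω).normAt z =
      ttwP p q α β ω (ttwL2 k α β z) (ttwH k α β ω z) := by
  rw [ttwProduct, TTWAlgebra.normAt_mul, TTWAlgebra.normAt_pow, TTWAlgebra.normAt_pow,
    show (ttwXElement k α β).normAt z = _ from ttwXfree_sq_add hz,
    show (ttwYElement k α β ω).normAt z = _ from ttwYfree_sq_add hz, ttwP]

/-- The bracket with `E` multiplies `A + t B` by `-g t` at the point `z`. -/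
structure TTWAlgebra.IsEigenvector (E : PhaseSpace 𝕜 2 → 𝕜) (z : PhaseSpace 𝕜 2) (g : 𝕜)
    (Z : TTWAlgebra k α β) : Prop where
  differentiable_re : DifferentiableAt 𝕜 Z.re z
  differentiable_im : DifferentiableAt 𝕜 Z.im z
  poisson_re : poisson E Z.re z = g * ttwL2 k α β z * Z.im z
  poisson_im : poisson E Z.im z = -g * Z.re z

/-- As `E` commutes with L₂, it commutes with t. The bracket with `E` is then a derivation of the
expressions A + tB, and logarithmic derivatives add. -/
theorem TTWAlgebra.IsEigenvector.mul {E : PhaseSpace 𝕜 2 → 𝕜} {g h : 𝕜} {Z W : TTWAlgebra k α β}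
    (hz : z ∈ phaseOver (ttwDomain k)) (hE : poisson E (ttwL2 k α β) z = 0)
    (hZ : Z.IsEigenvector E z g) (hW : W.IsEigenvector E z h) :
    (Z * W).IsEigenvector E z (g + h) := by
  have hL := differentiableAt_of_lead (hasMomentumLead_ttwL2 k α β) hz
  have hre : (Z * W).re = fun z => Z.re z * W.re z - ttwL2 k α β z * (Z.im z * W.im z) :=
    funext fun _ => TTWAlgebra.re_mul ..
  have him : (Z * W).im = fun z => Z.re z * W.im z + Z.im z * W.re z :=
    funext fun _ => TTWAlgebra.im_mul ..
  have h1 := hZ.differentiable_re.fun_mul hW.differentiable_re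
  have h2 := hZ.differentiable_im.fun_mul hW.differentiable_im
  have h3 := hZ.differentiable_re.fun_mul hW.differentiable_im
  have h4 := hZ.differentiable_im.fun_mul hW.differentiable_re
  refine ⟨?_, ?_, ?_, ?_⟩
  · rw [hre]; exact h1.fun_sub (hL.fun_mul h2)
  · rw [him]; exact h3.fun_add h4
  · rw [hre, poisson_sub h1 (hL.fun_mul h2), poisson_mul hL h2, hE,
      poisson_mul hZ.differentiable_re hW.differentiable_re,
      poisson_mul hZ.differentiable_im hW.differentiable_im, hZ.poisson_re, hZ.poisson_im,
      hW.poisson_re, hW.poisson_im, him]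
    ring
  · rw [him, poisson_add h3 h4, poisson_mul hZ.differentiable_re hW.differentiable_im,
      poisson_mul hZ.differentiable_im hW.differentiable_re, hZ.poisson_re, hZ.poisson_im,
      hW.poisson_re, hW.poisson_im, hre]
    ring

theorem TTWAlgebra.IsEigenvector.pow {E : PhaseSpace 𝕜 2 → 𝕜} {g : 𝕜} {Z : TTWAlgebra k α β}
    (hz : z ∈ phaseOver (ttwDomain k)) (hE : poisson E (ttwL2 k α β) z = 0)
    (hZ : Z.IsEigenvector E z g) (n : ℕ) : (Z ^ n).IsEigenvector E z (n * g) := by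
  induction n with
  | zero =>
    rw [pow_zero]
    have h1 : (1 : TTWAlgebra k α β).re = fun _ => 1 := rfl
    have h2 : (1 : TTWAlgebra k α β).im = fun _ => 0 := rfl
    refine ⟨?_, ?_, ?_, ?_⟩ <;> simp [h1, h2, poisson_const]
  | succ n ih =>
    have := ih.mul hz hE hZ
    rw [← pow_succ] at this
    convert this using 1
    push_cast
    ring

/-- Only X contributes: the parts of Y are built from r, p_r, L₂ and H, all of which commute with
L₂. -/
theorem isEigenvector_ttwProduct_ttwL2 (p q : ℕ) (hz : z ∈ phaseOver (ttwDomain k)) :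
    (ttwProduct p q k α β ω).IsEigenvector (ttwL2 k α β) z (4 * (q * k)) := by
  have hX : (ttwXElement k α β).IsEigenvector (ttwL2 k α β) z (4 * k) :=
    ⟨differentiableAt_of_lead (hasMomentumLead_ttwXfree k α β) hz,
      differentiableAt_of_lead (hasMomentumLead_ttwXcoeff k) hz,
      poisson_ttwL2_ttwXfree hz, poisson_ttwL2_ttwXcoeff hz⟩
  have hY : (ttwYElement k α β ω).IsEigenvector (ttwL2 k α β) z 0 :=
    ⟨differentiableAt_of_lead (hasMomentumLead_ttwYfree k α β ω) hz,
      differentiableAt_of_lead (hasMomentumLead_ttwYcoeff k) hz,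
      (poisson_ttwL2_ttwYfree hz).trans (by simp), (poisson_ttwL2_ttwYcoeff hz).trans (by simp)⟩
  have h := (hX.pow hz (poisson_self _ _) q).mul hz (poisson_self _ _)
    (hY.pow hz (poisson_self _ _) p)
  rw [ttwProduct]
  convert h using 1
  ring

/-- Here the exponents are forced: X contributes 4k/r² and Y contributes -4/r², so the q-th and p-th
powers balance exactly when qk = p. -/
theorem isEigenvector_ttwProduct_ttwH (p q : ℕ) (hz : z ∈ phaseOver (ttwDomain k))
    (hk : q * k = p) : (ttwProduct p q k α β ω).IsEigenvector (ttwH k α β ω) z 0 := by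
  have hX : (ttwXElement k α β).IsEigenvector (ttwH k α β ω) z (4 * k / z.1 0 ^ 2) :=
    ⟨differentiableAt_of_lead (hasMomentumLead_ttwXfree k α β) hz,
      differentiableAt_of_lead (hasMomentumLead_ttwXcoeff k) hz,
      poisson_ttwH_ttwXfree hz, poisson_ttwH_ttwXcoeff hz⟩
  have hY : (ttwYElement k α β ω).IsEigenvector (ttwH k α β ω) z (-(4 / z.1 0 ^ 2)) :=
    ⟨differentiableAt_of_lead (hasMomentumLead_ttwYfree k α β ω) hz,
      differentiableAt_of_lead (hasMomentumLead_ttwYcoeff k) hz,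
      poisson_ttwH_ttwYfree hz, (poisson_ttwH_ttwYcoeff hz).trans (by simp [ttwYElement])⟩
  have hE := poisson_ttwH_ttwL2 (α := α) (β := β) (ω := ω) hz
  have h := (hX.pow hz hE q).mul hz hE (hY.pow hz hE p)
  rw [ttwProduct]
  convert h using 1
  linear_combination (-(4 / z.1 0 ^ 2)) * hk

/-- Leading terms of `A + t B`, and division of `A - K` by `L₂`. -/
def TTWAlgebra.HasLead (Z : TTWAlgebra k α β) (m : ℕ) (gA gB : (Fin 2 → 𝕜) → 𝕜)
    (K : PhaseSpace 𝕜 2 → 𝕜) (gK : (Fin 2 → 𝕜) → 𝕜) : Prop :=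
  HasMomentumLead (ttwDomain k) 1 Z.re (m + 2) gA ∧
  HasMomentumLead (ttwDomain k) 1 Z.im (m + 1) gB ∧
  HasMomentumLead (ttwDomain k) 1 K (m + 2) gK ∧
  ∃ C, HasMomentumLead (ttwDomain k) 1 C m (fun x => gA x - gK x) ∧
    ∀ z ∈ phaseOver (ttwDomain k), Z.re z = K z + ttwL2 k α β z * C z

/-- Since t² = -L₂ vanishes modulo L₂, the real part is multiplicative modulo L₂. The explicit
quotient keeps track of its order and leading coefficient too. -/
theorem TTWAlgebra.HasLead.mul {Z W : TTWAlgebra k α β} {m n : ℕ}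
    {gA gB gK hA hB hK : (Fin 2 → 𝕜) → 𝕜} {K K' : PhaseSpace 𝕜 2 → 𝕜}
    (hZ : Z.HasLead m gA gB K gK) (hW : W.HasLead n hA hB K' hK) :
    (Z * W).HasLead (m + n + 2) (fun x => gA x * hA x - gB x * hB x)
      (fun x => gA x * hB x + gB x * hA x) (fun z => K z * K' z) (fun x => gK x * hK x) := by
  obtain ⟨hZA, hZB, hZK, C, hZC, hC⟩ := hZ
  obtain ⟨hWA, hWB, hWK, C', hWC, hC'⟩ := hW
  refine ⟨?_, ?_, ?_, fun z => K z * C' z + C z * W.re z - Z.im z * W.im z, ?_, ?_⟩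
  · have h1 := hZA.mul hWA
    have h2 := (hasMomentumLead_ttwL2 k α β).mul (hZB.mul hWB)
    rw [show 2 + (m + 1 + (n + 1)) = m + n + 2 + 2 by ring] at h2
    rw [show m + 2 + (n + 2) = m + n + 2 + 2 by ring] at h1
    exact (h1.sub h2).congr (fun z _ => (TTWAlgebra.re_mul Z W z).symm) (fun x _ => by ring)
  · have h1 := hZA.mul hWB
    have h2 := hZB.mul hWA
    rw [show m + 1 + (n + 2) = m + n + 2 + 1 by ring] at h2
    rw [show m + 2 + (n + 1) = m + n + 2 + 1 by ring] at h1
    exact (h1.add h2).congr (fun z _ => (TTWAlgebra.im_mul Z W z).symm) (fun x _ => rfl)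
  · have h1 := hZK.mul hWK
    rwa [show m + 2 + (n + 2) = m + n + 2 + 2 by ring] at h1
  · have h1 := hZK.mul hWC
    have h2 := hZC.mul hWA
    have h3 := hZB.mul hWB
    rw [show m + 2 + n = m + n + 2 by ring] at h1
    rw [show m + (n + 2) = m + n + 2 by ring] at h2
    rw [show m + 1 + (n + 1) = m + n + 2 by ring] at h3
    exact ((h1.add h2).sub h3).congr (fun z _ => rfl) (fun x _ => by ring)
  · intro z hz
    rw [TTWAlgebra.re_mul]
    linear_combination W.re z * hC z hz + K z * hC' z hz

theorem TTWAlgebra.HasLead.congr {Z : TTWAlgebra k α β} {m : ℕ}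
    {gA gB gK hA hB hK : (Fin 2 → 𝕜) → 𝕜} {K K' : PhaseSpace 𝕜 2 → 𝕜}
    (hZ : Z.HasLead m gA gB K gK) (h1 : Set.EqOn gA hA (ttwDomain k))
    (h2 : Set.EqOn gB hB (ttwDomain k)) (h3 : K = K') (h4 : Set.EqOn gK hK (ttwDomain k)) :
    Z.HasLead m hA hB K' hK := by
  subst h3
  obtain ⟨hZA, hZB, hZK, C, hZC, hC⟩ := hZ
  exact ⟨hZA.congr (fun _ _ => rfl) h1, hZB.congr (fun _ _ => rfl) h2,
    hZK.congr (fun _ _ => rfl) h4, C, hZC.congr (fun _ _ => rfl)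
    (fun x hx => by simp only [h1 hx, h4 hx]), hC⟩

/-- The leading coefficients of b and a are -cos 2kθ and sin 2kθ, so taking powers multiplies the
angle. Modulo L₂, b is α - β. The exponent is `n + 1` because the quotient by L₂ has order two less.
-/
theorem hasLead_ttwXElement_pow (n : ℕ) :
    (ttwXElement k α β ^ (n + 1)).HasLead (2 * n)
      (fun x => (-1) ^ (n + 1) * cosK (2 * ((n + 1 : ℕ) * k) * x 1))
      (fun x => -((-1) ^ (n + 1) * sinK (2 * ((n + 1 : ℕ) * k) * x 1)))
      (fun _ => (α - β) ^ (n + 1)) (fun _ => 0) := by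
  have h1 : (ttwXElement k α β).HasLead 0 (fun x => -cosK (2 * k * x 1))
      (fun x => sinK (2 * k * x 1)) (fun _ => α - β) (fun _ => 0) := by
    refine ⟨hasMomentumLead_ttwXfree k α β, hasMomentumLead_ttwXcoeff k,
      (HasMomentumLead.const _).of_lt zero_lt_two, fun z => -cosK (2 * k * z.1 1), ?_, ?_⟩
    · exact (HasMomentumLead.of_position (f := fun x => -cosK (2 * k * x 1))
        fun x _ => (analyticAt_cosK_position (2 * k) 1 x).neg).congr
        (fun _ _ => rfl) (fun x _ => by simp)
    · intro z _
      simp only [ttwXElement, ttwXfree]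
      ring
  induction n with
  | zero =>
    rw [zero_add, pow_one]
    exact h1.congr (fun x _ => by simp) (fun x _ => by simp) (by simp) (fun _ _ => rfl)
  | succ n ih =>
    rw [pow_succ]
    have h := ih.mul h1
    rw [show 2 * n + 0 + 2 = 2 * (n + 1) by ring] at h
    refine h.congr (fun x _ => ?_) (fun x _ => ?_) (funext fun _ => (pow_succ _ _).symm)
      (fun _ _ => by simp)
    · rw [show 2 * ((n + 1 + 1 : ℕ) * k) * x 1 = 2 * ((n + 1 : ℕ) * k) * x 1 + 2 * k * x 1 by
        push_cast; ring, cosK_add]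
      ring
    · rw [show 2 * ((n + 1 + 1 : ℕ) * k) * x 1 = 2 * ((n + 1 : ℕ) * k) * x 1 + 2 * k * x 1 by
        push_cast; ring, sinK_add]
      ring

/-- Modulo L₂, d is -H, with quotient 2/r². The other part c contains no p_θ, so the lead is just a
power of 1/r². -/
theorem hasLead_ttwYElement_pow (n : ℕ) :
    (ttwYElement k α β ω ^ (n + 1)).HasLead (2 * n)
      (fun x => (1 / x 0 ^ 2) ^ (n + 1)) (fun _ => 0)
      (fun z => (-ttwH k α β ω z) ^ (n + 1)) (fun x => (-(1 / x 0 ^ 2)) ^ (n + 1)) := by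
  have h1 : (ttwYElement k α β ω).HasLead 0 (fun x => 1 / x 0 ^ 2) (fun _ => 0)
      (fun z => -ttwH k α β ω z) (fun x => -(1 / x 0 ^ 2)) := by
    refine ⟨hasMomentumLead_ttwYfree k α β ω, hasMomentumLead_ttwYcoeff k,
      ((hasMomentumLead_ttwH k α β ω).const_mul (-1)).congr (fun _ _ => by simp)
        (fun _ _ => by simp), fun z => 2 / z.1 0 ^ 2, ?_, ?_⟩
    · exact (HasMomentumLead.of_position (analyticOnNhd_inv_radius_sq k 2)).congr
        (fun _ _ => rfl) (fun x _ => by ring)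
    · intro z _
      simp only [ttwYElement, ttwYfree]
      ring
  induction n with
  | zero =>
    rw [zero_add, pow_one]
    exact h1.congr (fun x _ => by simp) (fun x _ => by simp) (by simp) (fun _ _ => by simp)
  | succ n ih =>
    rw [pow_succ]
    have h := ih.mul h1
    rw [show 2 * n + 0 + 2 = 2 * (n + 1) by ring] at h
    exact h.congr (fun x _ => by rw [pow_succ]; ring) (fun x _ => by simp)
      (funext fun _ => (pow_succ _ _).symm) (fun _ _ => (pow_succ _ _).symm)

theorem hasLead_ttwProduct {p q : ℕ} (hp : 0 < p) (hq : 0 < q) (hk : q * k = p) :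
    (ttwProduct p q k α β ω).HasLead (2 * (p + q) - 2)
      (fun x => (-1) ^ q * (1 / x 0 ^ 2) ^ p * cosK (2 * p * x 1))
      (fun x => -((-1) ^ q * (1 / x 0 ^ 2) ^ p * sinK (2 * p * x 1)))
      (fun z => (α - β) ^ q * (-ttwH k α β ω z) ^ p) (fun _ => 0) := by
  obtain ⟨p, rfl⟩ := Nat.exists_eq_add_of_lt hp
  obtain ⟨q, rfl⟩ := Nat.exists_eq_add_of_lt hq
  rw [zero_add] at hk ⊢
  rw [zero_add] at hk ⊢
  have h := (hasLead_ttwXElement_pow (k := k) (α := α) (β := β) q).mul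
    (hasLead_ttwYElement_pow (ω := ω) p)
  rw [show 2 * q + 2 * p + 2 = 2 * (p + 1 + (q + 1)) - 2 by omega] at h
  rw [ttwProduct]
  exact h.congr (fun x _ => by rw [hk]; ring) (fun x _ => by rw [hk]; ring) rfl
    (fun x _ => by simp)

end TTW

/-! ### Polynomials in two functions -/

section BivariatePolynomials

open Polynomial

variable {𝕜 : Type*} [RCLike 𝕜]

theorem hasDerivAt_evalEval (Q : 𝕜[X][X]) (h l : 𝕜) :
    HasDerivAt (fun l => Q.evalEval h l) ((derivative Q).evalEval h l) l := by
  have := (Q.map (evalRingHom h)).hasDerivAt l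
  rw [derivative_map, map_evalRingHom_eval] at this
  simpa only [map_evalRingHom_eval] using this

/-- Taylor's formula of second order at `0`, in terms of the derivative at the other end. -/
theorem exists_sq_mul_evalEval (Q : 𝕜[X][X]) : ∃ G : 𝕜[X][X], ∀ h l : 𝕜,
    Q.evalEval h l - Q.evalEval h 0 - l * (derivative Q).evalEval h l =
      l ^ 2 * G.evalEval h l := by
  -- Writing Q = gl² + bl + a, one finds Q - a - lQ' = l²(-g - lg').
  refine ⟨-Q.divX.divX - X * derivative Q.divX.divX, fun h l => ?_⟩
  have hQ : Q = (Q.divX.divX * X + C (Q.divX.coeff 0)) * X + C (Q.coeff 0) := by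
    rw [divX_mul_X_add, divX_mul_X_add]
  generalize Q.divX.divX = g at *
  generalize Q.divX.coeff 0 = b at *
  generalize Q.coeff 0 = a at *
  subst hQ
  simp only [derivative_add, derivative_mul, derivative_X, derivative_C, evalEval_add,
    evalEval_mul, evalEval_X, evalEval_C, evalEval_sub, evalEval_neg, evalEval_one, evalEval_zero]
  ring

variable {n N : ℕ} {U : Set (PhaseSpace 𝕜 n)} {g : Fin N → PhaseSpace 𝕜 n → 𝕜}
  {F G : PhaseSpace 𝕜 n → 𝕜}

theorem polynomialsIn_eval (hF : F ∈ polynomialsIn U g) (a : 𝕜[X]) :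
    (fun z => a.eval (F z)) ∈ polynomialsIn U g := by
  induction a using Polynomial.induction_on' with
  | add a b ha hb => simpa only [eval_add] using polynomialsIn_add ha hb
  | monomial k c =>
    simpa only [eval_monomial] using polynomialsIn_const_mul c (polynomialsIn_pow hF k)

theorem polynomialsIn_evalEval (hF : F ∈ polynomialsIn U g) (hG : G ∈ polynomialsIn U g)
    (Q : 𝕜[X][X]) : (fun z => Q.evalEval (F z) (G z)) ∈ polynomialsIn U g := by
  induction Q using Polynomial.induction_on' with
  | add a b ha hb => simpa only [evalEval_add] using polynomialsIn_add ha hb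
  | monomial k c =>
    simpa only [evalEval, eval_monomial, eval_mul, eval_pow, eval_C] using
      polynomialsIn_mul (polynomialsIn_eval hF c) (polynomialsIn_pow hG k)

theorem analyticOnNhd_evalEval (hF : AnalyticOnNhd 𝕜 F U) (hG : AnalyticOnNhd 𝕜 G U)
    (Q : 𝕜[X][X]) : AnalyticOnNhd 𝕜 (fun z => Q.evalEval (F z) (G z)) U := by
  induction Q using Polynomial.induction_on' with
  | add a b ha hb =>
    simp only [evalEval_add]
    exact fun z hz => (ha z hz).fun_add (hb z hz)
  | monomial k c =>
    simp only [evalEval, eval_monomial, eval_mul, eval_pow, eval_C]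
    exact fun z hz => ((hF z hz).aeval_polynomial c).fun_mul ((hG z hz).fun_pow k)

/-- The bracket with a function that commutes with `F`. -/
theorem poisson_evalEval {E : PhaseSpace 𝕜 n → 𝕜} {z : PhaseSpace 𝕜 n}
    (hF : DifferentiableAt 𝕜 F z) (hG : DifferentiableAt 𝕜 G z) (hEF : poisson E F z = 0)
    (Q : 𝕜[X][X]) : DifferentiableAt 𝕜 (fun z => Q.evalEval (F z) (G z)) z ∧
      poisson E (fun z => Q.evalEval (F z) (G z)) z =
      (derivative Q).evalEval (F z) (G z) * poisson E G z := by
  induction Q using Polynomial.induction_on' with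
  | add a b ha hb =>
    simp only [evalEval_add, derivative_add]
    refine ⟨ha.1.fun_add hb.1, ?_⟩
    rw [poisson_add ha.1 hb.1, ha.2, hb.2]
    ring
  | monomial k c =>
    have hc : HasDerivAt (fun y => c.eval y) ((derivative c).eval (F z)) (F z) := c.hasDerivAt _
    have hd : DifferentiableAt 𝕜 (fun w => c.eval (F w)) z :=
      (hc.comp_hasFDerivAt z hF.hasFDerivAt).differentiableAt
    simp only [derivative_monomial, evalEval, eval_monomial, eval_mul, eval_pow, eval_C]
    refine ⟨hd.fun_mul (hG.fun_pow k), ?_⟩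
    rw [poisson_mul hd (hG.fun_pow k), poisson_comp hc hF, hEF, poisson_pow hG]
    simp only [eval_natCast]
    ring

/-- `P` as a polynomial in `l` with coefficients in the polynomials in `h`. -/
def ttwPoly (p q : ℕ) (α β ω : 𝕜) : 𝕜[X][X] :=
  ((X - CC α - CC β) ^ 2 - CC (4 * α * β)) ^ q * (C X ^ 2 - CC (4 * ω ^ 2) * X) ^ p

theorem evalEval_ttwPoly (p q : ℕ) (α β ω h l : 𝕜) :
    (ttwPoly p q α β ω).evalEval h l = ttwP p q α β ω l h := by
  simp [ttwPoly, ttwP, evalEval_sub, evalEval_mul, evalEval_pow, evalEval_C]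

end BivariatePolynomials

/-! ### Functional independence -/

section Independence

variable {𝕜 : Type*} [RCLike 𝕜]

/-- Turns a linear relation between differentials into scalar equations, one for each choice of `E`.
-/
theorem poisson_sum_eq_zero {n N : ℕ} {f : Fin N → PhaseSpace 𝕜 n → 𝕜} {z : PhaseSpace 𝕜 n}
    {c : Fin N → 𝕜} (h : ∑ i, c i • fderiv 𝕜 (f i) z = 0) (E : PhaseSpace 𝕜 n → 𝕜) :
    ∑ i, c i * poisson E (f i) z = 0 := by
  have hv (v : PhaseSpace 𝕜 n) : ∑ i, c i * fderiv 𝕜 (f i) z v = 0 := by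
    simpa using congrArg (fun L => L v) h
  simp only [poisson, partialPos, partialMom, Finset.mul_sum]
  rw [Finset.sum_comm]
  refine Finset.sum_eq_zero fun j _ => ?_
  have h1 := hv (Pi.single j 1, 0)
  have h2 := hv (0, Pi.single j 1)
  calc _ = fderiv 𝕜 E z (0, Pi.single j 1) * ∑ i, c i * fderiv 𝕜 (f i) z (Pi.single j 1, 0) -
        fderiv 𝕜 E z (Pi.single j 1, 0) * ∑ i, c i * fderiv 𝕜 (f i) z (0, Pi.single j 1) := by
        rw [Finset.mul_sum, Finset.mul_sum, ← Finset.sum_sub_distrib]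
        exact Finset.sum_congr rfl fun i _ => by ring
    _ = 0 := by rw [h1, h2]; ring

/-- A proper range lies in the kernel of a nonzero functional, whose coefficients are a linear
relation among the `f i`. -/
theorem range_pi_eq_top {E : Type*} [NormedAddCommGroup E] [NormedSpace 𝕜 E] {N : ℕ}
    {f : Fin N → E →L[𝕜] 𝕜} (hf : LinearIndependent 𝕜 f) :
    (ContinuousLinearMap.pi f).range = ⊤ := by
  by_contra hne
  obtain ⟨φ, hφ, hle⟩ := Submodule.exists_le_ker_of_lt_top _ (lt_top_iff_ne_top.mpr hne)
  apply hφ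
  have hsum (w : Fin N → 𝕜) : φ w = ∑ i, φ (Pi.single i 1) * w i := by
    conv_lhs => rw [pi_eq_sum_univ' w, map_sum]
    refine Finset.sum_congr rfl fun i _ => ?_
    rw [map_smul, smul_eq_mul, mul_comm]
  have h0 := Fintype.linearIndependent_iff.mp hf (fun i => φ (Pi.single i 1)) (by
    ext v
    have : φ (ContinuousLinearMap.pi f v) = 0 := hle ⟨v, rfl⟩
    rw [hsum] at this
    simpa using this)
  refine LinearMap.ext fun w => ?_
  rw [hsum]
  simp [h0]

/-- Generically independent functions are algebraically independent. -/
theorem eq_of_eval_eq_of_genericallyIndependent {n N : ℕ} {U : Set (PhaseSpace 𝕜 n)}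
    (hU : IsOpen U) (hne : U.Nonempty) {f : Fin N → PhaseSpace 𝕜 n → 𝕜}
    (hf : GenericallyIndependent U f) {Φ Ψ : MvPolynomial (Fin N) 𝕜}
    (h : ∀ z ∈ U, Φ.eval (fun i => f i z) = Ψ.eval (fun i => f i z)) : Φ = Ψ := by
  obtain ⟨V, hVU, hV, hUV, hana, hind⟩ := hf
  obtain ⟨z, hz⟩ : V.Nonempty := closure_nonempty_iff.mp (hne.mono hUV)
  have hstrict : HasStrictFDerivAt (fun w i => f i w)
      (ContinuousLinearMap.pi fun i => fderiv 𝕜 (f i) z) z :=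
    hasStrictFDerivAt_pi.mpr fun i => (hana i z hz).hasStrictFDerivAt
  -- Full rank makes the map open at `z`, so its image contains a product of neighbourhoods in 𝕜.
  -- These are infinite sets, on whose product a polynomial is determined by its values.
  have hmap := hstrict.map_nhds_eq_of_surj (range_pi_eq_top (hind z hz))
  have himg : (fun w i => f i w) '' U ∈ nhds (fun i => f i z) := by
    rw [← hmap]
    exact Filter.image_mem_map (hU.mem_nhds (hVU hz))
  rw [nhds_pi, Filter.mem_pi] at himg
  obtain ⟨I, -, t, ht, hsub⟩ := himg
  refine MvPolynomial.funext_set t (fun i => infinite_of_mem_nhds _ (ht i)) fun x hx => ?_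
  obtain ⟨w, hw, rfl⟩ := hsub fun i _ => hx i trivial
  exact h w hw

end Independence

/-! ### Generic nonvanishing and independence for the TTW system -/

section TTWGeneric

variable {𝕜 : Type*} [RCLike 𝕜] {k α β ω : 𝕜}

theorem subset_closure_ne_zero_of_lead {D : Set (Fin 2 → 𝕜)} {i : Fin 2}
    {F : PhaseSpace 𝕜 2 → 𝕜} {N : ℕ} {f : (Fin 2 → 𝕜) → 𝕜} (hF : HasMomentumLead D i F N f)
    (hf : phaseOver D ⊆ closure {z | z ∈ phaseOver D ∧ f z.1 ≠ 0}) :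
    phaseOver D ⊆ closure {z | z ∈ phaseOver D ∧ F z ≠ 0} :=
  hf.trans (closure_minimal (fun _ hz => hF.mem_closure_ne_zero hz.1 hz.2) isClosed_closure)

theorem subset_closure_sinK_ne_zero {D : Set (Fin 2 → 𝕜)} (hD : IsOpen D) {c : 𝕜} (hc : c ≠ 0) :
    phaseOver D ⊆ closure {z | z ∈ phaseOver D ∧ sinK (c * z.1 1) ≠ 0} := by
  intro z hz
  have hcont : Filter.Tendsto (fun y => (Function.update z.1 1 y, z.2))
      (nhdsWithin (z.1 1) {z.1 1}ᶜ) (nhds z) := by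
    have : Continuous fun y : 𝕜 => (Function.update z.1 1 y, z.2) := by fun_prop
    have h := this.tendsto (z.1 1)
    simp only [Function.update_eq_self] at h
    exact h.mono_left nhdsWithin_le_nhds
  refine mem_closure_of_tendsto hcont ?_
  filter_upwards [hcont.eventually ((isOpen_phaseOver hD).mem_nhds hz),
    eventually_sinK_mul_ne_zero hc (z.1 1)] with y h1 h2
  exact ⟨h1, by simpa using h2⟩

theorem ttwDomain_nonempty (hk : k ≠ 0) : (ttwDomain k).Nonempty :=
  -- With θ = 1/k the argument kθ is 1, where sine and cosine are both nonzero.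
  ⟨![1, k⁻¹], by simp, by simp [hk, sinK_one_ne_zero], by simp [hk, cosK_one_ne_zero]⟩

/-- A relation among the differentials is tested against L₂, r and θ. The bracket with L₂ isolates
the coefficient of `F`. Then r isolates that of H, since it commutes with L₂, and θ leaves that of
L₂. The factors met are G, 2p_r and 2p_θ, all nonzero on a dense open set. -/
theorem genericallyIndependent_of_poisson {F G : PhaseSpace 𝕜 2 → 𝕜}
    (hF : AnalyticOnNhd 𝕜 F (phaseOver (ttwDomain k)))
    (hG : ContinuousOn G (phaseOver (ttwDomain k)))
    (hFG : ∀ z ∈ phaseOver (ttwDomain k), poisson (ttwL2 k α β) F z = G z)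
    (hG0 : phaseOver (ttwDomain k) ⊆ closure {z | z ∈ phaseOver (ttwDomain k) ∧ G z ≠ 0}) :
    GenericallyIndependent (phaseOver (ttwDomain k)) ![ttwH k α β ω, ttwL2 k α β, F] := by
  have hD := isOpen_ttwDomain k
  have hU := isOpen_phaseOver hD
  have hH := (hasMomentumLead_ttwH k α β ω).analyticOnNhd hD
  have hL := (hasMomentumLead_ttwL2 k α β).analyticOnNhd hD
  have hmom (i : Fin 2) : phaseOver (ttwDomain k) ⊆
      closure {z | z ∈ phaseOver (ttwDomain k) ∧ z.2 i ≠ 0} :=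
    subset_closure_ne_zero_of_lead (i := i) (HasMomentumLead.momentum i)
      (fun z hz => subset_closure ⟨hz, by simp⟩)
  have hcont (i : Fin 2) : ContinuousOn (fun z : PhaseSpace 𝕜 2 => z.2 i)
    (phaseOver (ttwDomain k)) := by fun_prop
  have hdense := subset_closure_mul_ne_zero hU ((hcont 0).mul (hcont 1))
    (subset_closure_mul_ne_zero hU (hcont 0) (hmom 0) (hmom 1)) hG0
  refine ⟨_, fun z hz => hz.1, isOpen_setOf_mem_and_ne_zero hU (((hcont 0).mul (hcont 1)).mul hG),
    hdense, fun i z hz => ?_, ?_⟩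
  · fin_cases i
    · exact hH z hz.1
    · exact hL z hz.1
    · exact hF z hz.1
  · rintro z ⟨hz, hne⟩
    have hne' : z.2 0 * z.2 1 * G z ≠ 0 := hne
    have hGz : G z ≠ 0 := right_ne_zero_of_mul hne'
    have h01 := left_ne_zero_of_mul hne'
    have h0 := left_ne_zero_of_mul h01
    have h1 := right_ne_zero_of_mul h01
    rw [Fintype.linearIndependent_iff]
    intro c hc
    have hsum := poisson_sum_eq_zero hc
    have e1 := hsum (ttwL2 k α β)
    have e2 := hsum (fun w => w.1 0)
    have e3 := hsum (fun w => w.1 1)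
    have hHr := poisson_ttwH_radius (α := α) (β := β) (ω := ω) hz
    have hLr := poisson_ttwL2_radius (α := α) (β := β) hz
    have hLa := poisson_ttwL2_angle (α := α) (β := β) hz
    rw [poisson_antisymm] at hHr hLr hLa
    simp only [Fin.sum_univ_three, Matrix.cons_val_zero, Matrix.cons_val_one,
      Matrix.cons_val_two, Matrix.tail_cons, Matrix.head_cons] at e1 e2 e3
    rw [poisson_ttwL2_ttwH hz, poisson_self, hFG z hz] at e1
    have c2 : c 2 = 0 := by simpa [hGz] using e1
    have c0 : c 0 = 0 := by
      have : c 0 * (2 * z.2 0) = 0 := by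
        linear_combination -e2 - c 0 * hHr - c 1 * hLr +
          poisson (fun w => w.1 0) F z * c2
      simpa [h0] using this
    have c1 : c 1 = 0 := by
      have : c 1 * (2 * z.2 1) = 0 := by
        linear_combination -e3 - c 1 * hLa + poisson (fun w => w.1 1) (ttwH k α β ω) z * c0 +
          poisson (fun w => w.1 1) F z * c2
      simpa [h1] using this
    intro i
    fin_cases i
    · exact c0
    · exact c1
    · exact c2

end TTWGeneric

/-! ### The structure of the symmetry algebra -/

section Structure

open Polynomial

variable {𝕜 : Type*} [RCLike 𝕜]

/-- Brackets and relations of the constants of the motion of the TTW system. -/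
structure IsTTWSystem {n : ℕ} (p q : ℕ) (α β ω κ : 𝕜) (U : Set (PhaseSpace 𝕜 n))
    (H L2 L3 L4 L5 : PhaseSpace 𝕜 n → 𝕜) : Prop where
  pos : 0 < p
  isOpen : IsOpen U
  nonempty : U.Nonempty
  analytic_H : AnalyticOnNhd 𝕜 H U
  analytic_L2 : AnalyticOnNhd 𝕜 L2 U
  analytic_L3 : AnalyticOnNhd 𝕜 L3 U
  analytic_L4 : AnalyticOnNhd 𝕜 L4 U
  analytic_L5 : AnalyticOnNhd 𝕜 L5 U
  bracket_H_L2 : ∀ z ∈ U, poisson H L2 z = 0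
  bracket_H_L3 : ∀ z ∈ U, poisson H L3 z = 0
  bracket_H_L4 : ∀ z ∈ U, poisson H L4 z = 0
  bracket_L2_L3 : ∀ z ∈ U, poisson L2 L3 z = 4 * p * L2 z * L4 z
  bracket_L2_L4 : ∀ z ∈ U, poisson L2 L4 z = -4 * p * L3 z
  relation : ∀ z ∈ U, L3 z ^ 2 + L2 z * L4 z ^ 2 = 4 * ttwP p q α β ω (L2 z) (H z)
  decomposition : ∀ z ∈ U, L3 z = κ * H z ^ p + L2 z * L5 z
  sq_const : κ ^ 2 = 4 * ((α - β) ^ q) ^ 2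
  dense_L2 : U ⊆ closure {z | z ∈ U ∧ L2 z ≠ 0}
  dense_L3 : U ⊆ closure {z | z ∈ U ∧ L3 z ≠ 0}
  independent : GenericallyIndependent U ![H, L2, L4]

namespace IsTTWSystem

variable {n p q : ℕ} {α β ω κ : 𝕜} {U : Set (PhaseSpace 𝕜 n)}
  {H L2 L3 L4 L5 : PhaseSpace 𝕜 n → 𝕜} {z : PhaseSpace 𝕜 n}

theorem four_mul_ne_zero (h : IsTTWSystem p q α β ω κ U H L2 L3 L4 L5) : (4 * p : 𝕜) ≠ 0 :=
  mul_ne_zero (by norm_num) (Nat.cast_ne_zero.mpr h.pos.ne')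

/-- The term κH^p is invisible to any `E` that commutes with H. -/
theorem poisson_decomposition (h : IsTTWSystem p q α β ω κ U H L2 L3 L4 L5) (hz : z ∈ U)
    {E : PhaseSpace 𝕜 n → 𝕜} (hE : poisson E H z = 0) :
    poisson E L3 z = L2 z * poisson E L5 z + L5 z * poisson E L2 z := by
  have hH := (h.analytic_H z hz).differentiableAt
  have h2 := (h.analytic_L2 z hz).differentiableAt
  have h5 := (h.analytic_L5 z hz).differentiableAt
  rw [poisson_congr h.isOpen (Set.eqOn_refl _ _) (fun w hw => h.decomposition w hw) hz,
    poisson_add ((hH.fun_pow p).const_mul κ) (h2.fun_mul h5), poisson_const_mul _ (hH.fun_pow p),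
    poisson_pow hH, hE, poisson_mul h2 h5]
  ring

theorem bracket_H_L5 (h : IsTTWSystem p q α β ω κ U H L2 L3 L4 L5) (hz : z ∈ U) :
    poisson H L5 z = 0 := by
  refine eqOn_of_mul_eq_mul h.dense_L2
    (continuousOn_poisson h.analytic_H h.analytic_L5) (G := fun _ => 0) continuousOn_const
    (fun w hw => ?_) hz
  have h3 := h.poisson_decomposition hw (poisson_self H w)
  rw [h.bracket_H_L3 w hw, h.bracket_H_L2 w hw] at h3
  linear_combination -h3

theorem bracket_L2_L5 (h : IsTTWSystem p q α β ω κ U H L2 L3 L4 L5) (hz : z ∈ U) :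
    poisson L2 L5 z = 4 * p * L4 z := by
  refine eqOn_of_mul_eq_mul h.dense_L2
    (continuousOn_poisson h.analytic_L2 h.analytic_L5) (G := fun z => 4 * p * L4 z)
    (continuousOn_const.mul h.analytic_L4.continuousOn) (fun w hw => ?_) hz
  have h3 := h.poisson_decomposition (E := L2) hw (by
    rw [poisson_antisymm, h.bracket_H_L2 w hw, neg_zero])
  rw [h.bracket_L2_L3 w hw, poisson_self] at h3
  linear_combination -h3

/-- The derivative of `P` with respect to `l`. -/
theorem deriv_ttwP (p q : ℕ) (α β ω l x : 𝕜) :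
    deriv (fun l => ttwP p q α β ω l x) l =
      (derivative (ttwPoly p q α β ω)).evalEval x l := by
  simpa only [evalEval_ttwPoly] using (hasDerivAt_evalEval (ttwPoly p q α β ω) x l).deriv

/-- Bracketing the relation L₃² + L₂L₄² = 4P with L₄ and using {L₄, L₂} = 4pL₃ leaves a common
factor L₃, which cancels generically. -/
theorem bracket_L4_L3 (h : IsTTWSystem p q α β ω κ U H L2 L3 L4 L5) (hz : z ∈ U) :
    poisson L4 L3 z = 8 * p * (derivative (ttwPoly p q α β ω)).evalEval (H z) (L2 z) -
      2 * p * L4 z ^ 2 := by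
  refine eqOn_of_mul_eq_mul h.dense_L3
    (continuousOn_poisson h.analytic_L4 h.analytic_L3)
    (G := fun z => 8 * p * (derivative (ttwPoly p q α β ω)).evalEval (H z) (L2 z) -
      2 * p * L4 z ^ 2)
    ((continuousOn_const.mul
      (analyticOnNhd_evalEval h.analytic_H h.analytic_L2 _).continuousOn).sub
      (continuousOn_const.mul (h.analytic_L4.continuousOn.pow 2))) (fun w hw => ?_) hz
  have hH := (h.analytic_H w hw).differentiableAt
  have h2 := (h.analytic_L2 w hw).differentiableAt
  have h3 := (h.analytic_L3 w hw).differentiableAt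
  have h4 := (h.analytic_L4 w hw).differentiableAt
  have h4H : poisson L4 H w = 0 := by rw [poisson_antisymm, h.bracket_H_L4 w hw, neg_zero]
  have h42 : poisson L4 L2 w = 4 * p * L3 w := by
    rw [poisson_antisymm, h.bracket_L2_L4 w hw]; ring
  obtain ⟨hPd, hP⟩ := poisson_evalEval hH h2 h4H (ttwPoly p q α β ω)
  have e : poisson L4 (fun z => L3 z ^ 2 + L2 z * L4 z ^ 2) w =
      poisson L4 (fun z => 4 * (ttwPoly p q α β ω).evalEval (H z) (L2 z)) w :=
    poisson_congr h.isOpen (Set.eqOn_refl _ _)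
      (fun z hz => by simp only [evalEval_ttwPoly, h.relation z hz]) hw
  rw [poisson_add (h3.fun_pow 2) (h2.fun_mul (h4.fun_pow 2)), poisson_pow h3,
    poisson_mul h2 (h4.fun_pow 2), poisson_pow h4, poisson_self, poisson_const_mul _ hPd, hP,
    h42] at e
  norm_num at e
  linear_combination e / 2

/-- Inserting L₃ = κH^p + L₂L₅ into {L₄, L₃} determines L₂²{L₅, L₄}. By the quadratic relation this
is 8p(P - P(0,H) - L₂ ∂P/∂L₂) + 2pL₂²L₅². The bracket in the first term is divisible by L₂², so
division gives a polynomial. -/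
theorem bracket_L5_L4 (h : IsTTWSystem p q α β ω κ U H L2 L3 L4 L5) :
    ∃ G : 𝕜[X][X], ∀ z ∈ U,
      poisson L5 L4 z = 8 * p * G.evalEval (H z) (L2 z) + 2 * p * L5 z ^ 2 := by
  obtain ⟨G, hG⟩ := exists_sq_mul_evalEval (ttwPoly p q α β ω)
  refine ⟨G, fun z hz => ?_⟩
  refine eqOn_of_mul_eq_mul (E := fun z => L2 z * L2 z)
    (subset_closure_mul_ne_zero h.isOpen h.analytic_L2.continuousOn h.dense_L2 h.dense_L2)
    (continuousOn_poisson h.analytic_L5 h.analytic_L4)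
    (G := fun z => 8 * p * G.evalEval (H z) (L2 z) + 2 * p * L5 z ^ 2)
    ((continuousOn_const.mul
      (analyticOnNhd_evalEval h.analytic_H h.analytic_L2 _).continuousOn).add
      (continuousOn_const.mul (h.analytic_L5.continuousOn.pow 2))) (fun w hw => ?_) hz
  have h4H : poisson L4 H w = 0 := by rw [poisson_antisymm, h.bracket_H_L4 w hw, neg_zero]
  have e := h.poisson_decomposition hw h4H
  have h42 : poisson L4 L2 w = 4 * p * L3 w := by
    rw [poisson_antisymm, h.bracket_L2_L4 w hw]; ring
  rw [h.bracket_L4_L3 hw, h42, poisson_antisymm L4 L5] at e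
  have hTaylor := hG (H w) (L2 w)
  -- At L₂ = 0 the polynomial P is the perfect square (α - β)^(2q) H^(2p). The constant κ is chosen
  -- to match it.
  have hP0 : 4 * (ttwPoly p q α β ω).evalEval (H w) 0 = κ ^ 2 * (H w ^ p) ^ 2 := by
    rw [evalEval_ttwPoly, ttwP, h.sq_const,
      show (0 - α - β) ^ 2 - 4 * α * β = (α - β) ^ 2 by ring, ← pow_mul, ← pow_mul,
      show H w ^ 2 - 4 * ω ^ 2 * 0 = H w ^ 2 by ring, ← pow_mul, ← pow_mul, mul_comm q 2,
      mul_comm p 2]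
    ring
  have hrel := h.relation w hw
  rw [← evalEval_ttwPoly] at hrel
  have hdec := h.decomposition w hw
  generalize (ttwPoly p q α β ω).evalEval (H w) (L2 w) = P at *
  generalize (ttwPoly p q α β ω).evalEval (H w) 0 = P0 at *
  generalize (derivative (ttwPoly p q α β ω)).evalEval (H w) (L2 w) = P' at *
  generalize G.evalEval (H w) (L2 w) = g at *
  generalize poisson L5 L4 w = b at *
  generalize H w ^ p = y at *
  rw [hdec] at e hrel
  linear_combination L2 w * e + 8 * (p : 𝕜) * hTaylor + 2 * p * hrel + 2 * p * hP0

/-- By antisymmetry six brackets decide whether four functions generate a closed algebra. -/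
theorem consistsOf_four (hU : IsOpen U) {F₀ F₁ F₂ F₃ : PhaseSpace 𝕜 n → 𝕜}
    {S : Set (PhaseSpace 𝕜 n → 𝕜)} (h0 : AnalyticOnNhd 𝕜 F₀ U) (h1 : AnalyticOnNhd 𝕜 F₁ U)
    (h2 : AnalyticOnNhd 𝕜 F₂ U) (h3 : AnalyticOnNhd 𝕜 F₃ U)
    (h01 : poisson F₀ F₁ ∈ polynomialsIn U ![F₀, F₁, F₂, F₃])
    (h02 : poisson F₀ F₂ ∈ polynomialsIn U ![F₀, F₁, F₂, F₃])
    (h03 : poisson F₀ F₃ ∈ polynomialsIn U ![F₀, F₁, F₂, F₃])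
    (h12 : poisson F₁ F₂ ∈ polynomialsIn U ![F₀, F₁, F₂, F₃])
    (h13 : poisson F₁ F₃ ∈ polynomialsIn U ![F₀, F₁, F₂, F₃])
    (h23 : poisson F₂ F₃ ∈ polynomialsIn U ![F₀, F₁, F₂, F₃])
    (hS : S ⊆ polynomialsIn U ![F₀, F₁, F₂, F₃]) :
    ConsistsOfPolynomialsIn U (symmetryAlgebra U S) ![F₀, F₁, F₂, F₃] := by
  have hself (F : PhaseSpace 𝕜 n → 𝕜) : poisson F F ∈ polynomialsIn U ![F₀, F₁, F₂, F₃] :=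
    polynomialsIn_congr (polynomialsIn_const 0) fun z _ => (poisson_self F z).symm
  have hswap {F G : PhaseSpace 𝕜 n → 𝕜} (h : poisson F G ∈ polynomialsIn U ![F₀, F₁, F₂, F₃]) :
      poisson G F ∈ polynomialsIn U ![F₀, F₁, F₂, F₃] :=
    polynomialsIn_congr (polynomialsIn_const_mul (-1) h) fun z _ => by
      rw [poisson_antisymm G]; ring
  refine consistsOfPolynomialsIn_symmetryAlgebra hU (fun i z hz => ?_) (fun i j => ?_) hS
  · fin_cases i
    exacts [(h0 z hz).differentiableAt, (h1 z hz).differentiableAt, (h2 z hz).differentiableAt,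
      (h3 z hz).differentiableAt]
  · fin_cases i <;> fin_cases j
    exacts [hself _, h01, h02, h03, hswap h01, hself _, h12, h13, hswap h02, hswap h12, hself _,
      h23, hswap h03, hswap h13, hswap h23, hself _]

theorem polynomialsIn_zero {N : ℕ} {g : Fin N → PhaseSpace 𝕜 n → 𝕜} {F : PhaseSpace 𝕜 n → 𝕜}
    (hF : ∀ z ∈ U, F z = 0) : F ∈ polynomialsIn U g :=
  polynomialsIn_congr (polynomialsIn_const 0) fun z hz => (hF z hz).symm

theorem analytic_const_mul {F : PhaseSpace 𝕜 n → 𝕜} (hF : AnalyticOnNhd 𝕜 F U) (a : 𝕜) :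
    AnalyticOnNhd 𝕜 (fun z => a * F z) U := fun z hz => analyticAt_const.mul (hF z hz)

theorem bracket_L4_R (h : IsTTWSystem p q α β ω κ U H L2 L3 L4 L5) (hz : z ∈ U) :
    poisson L4 (fun z => -4 * (p : 𝕜) * L3 z) z = 8 * (p : 𝕜) ^ 2 * L4 z ^ 2 -
      32 * (p : 𝕜) ^ 2 * (derivative (ttwPoly p q α β ω)).evalEval (H z) (L2 z) := by
  rw [poisson_const_mul _ (h.analytic_L3 z hz).differentiableAt, h.bracket_L4_L3 hz]
  ring

theorem bracket_L2_R (h : IsTTWSystem p q α β ω κ U H L2 L3 L4 L5) (hz : z ∈ U) :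
    poisson L2 (fun z => -4 * (p : 𝕜) * L3 z) z = -16 * (p : 𝕜) ^ 2 * L2 z * L4 z := by
  rw [poisson_const_mul _ (h.analytic_L3 z hz).differentiableAt, h.bracket_L2_L3 z hz]
  ring

theorem consistsOf_L4 (h : IsTTWSystem p q α β ω κ U H L2 L3 L4 L5) :
    ConsistsOfPolynomialsIn U (symmetryAlgebra U {H, L2, L3, L4})
      ![H, L2, L4, fun z => -4 * (p : 𝕜) * L3 z] := by
  set g : Fin 4 → PhaseSpace 𝕜 n → 𝕜 := ![H, L2, L4, fun z => -4 * (p : 𝕜) * L3 z] with hg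
  have g0 : H ∈ polynomialsIn U g := polynomialsIn_gen 0
  have g1 : L2 ∈ polynomialsIn U g := polynomialsIn_gen 1
  have g2 : L4 ∈ polynomialsIn U g := polynomialsIn_gen 2
  have g3 : (fun z => -4 * (p : 𝕜) * L3 z) ∈ polynomialsIn U g := polynomialsIn_gen 3
  refine consistsOf_four h.isOpen h.analytic_H h.analytic_L2 h.analytic_L4
    (analytic_const_mul h.analytic_L3 _) (polynomialsIn_zero h.bracket_H_L2)
    (polynomialsIn_zero h.bracket_H_L4) (polynomialsIn_zero fun z hz => ?_)
    (polynomialsIn_congr g3 fun z hz => (h.bracket_L2_L4 z hz).symm)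
    (polynomialsIn_congr (polynomialsIn_const_mul (-16 * (p : 𝕜) ^ 2) (polynomialsIn_mul g1 g2))
      fun z hz => ?_)
    (polynomialsIn_congr (polynomialsIn_sub
      (polynomialsIn_const_mul (8 * (p : 𝕜) ^ 2) (polynomialsIn_pow g2 2))
      (polynomialsIn_const_mul (32 * (p : 𝕜) ^ 2) (polynomialsIn_evalEval g0 g1 _)))
      fun z hz => (h.bracket_L4_R hz).symm) ?_
  · rw [poisson_const_mul _ (h.analytic_L3 z hz).differentiableAt, h.bracket_H_L3 z hz, mul_zero]
  · rw [h.bracket_L2_R hz]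
    ring
  · rintro F (rfl | rfl | rfl | rfl)
    · exact g0
    · exact g1
    · refine polynomialsIn_congr (polynomialsIn_const_mul (-(4 * (p : 𝕜))⁻¹) g3) fun z _ => ?_
      have := h.four_mul_ne_zero
      have hp : (p : 𝕜) ≠ 0 := right_ne_zero_of_mul this
      field_simp
    · exact g2

theorem consistsOf_L5 (h : IsTTWSystem p q α β ω κ U H L2 L3 L4 L5) :
    ConsistsOfPolynomialsIn U (symmetryAlgebra U {H, L2, L5}) ![H, L2, L5, poisson L2 L5] := by
  -- The bracket {L₂, L₅} is replaced by its value 4pL₄ on `U`, whose analyticity and brackets are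
  -- known.
  have key : ConsistsOfPolynomialsIn U (symmetryAlgebra U {H, L2, L5})
      ![H, L2, L5, fun z => 4 * (p : 𝕜) * L4 z] := by
    set g : Fin 4 → PhaseSpace 𝕜 n → 𝕜 := ![H, L2, L5, fun z => 4 * (p : 𝕜) * L4 z] with hg
    have g0 : H ∈ polynomialsIn U g := polynomialsIn_gen 0
    have g1 : L2 ∈ polynomialsIn U g := polynomialsIn_gen 1
    have g2 : L5 ∈ polynomialsIn U g := polynomialsIn_gen 2
    have g3 : (fun z => 4 * (p : 𝕜) * L4 z) ∈ polynomialsIn U g := polynomialsIn_gen 3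
    obtain ⟨G, hG⟩ := h.bracket_L5_L4
    refine consistsOf_four h.isOpen h.analytic_H h.analytic_L2 h.analytic_L5
      (analytic_const_mul h.analytic_L4 _) (polynomialsIn_zero h.bracket_H_L2)
      (polynomialsIn_zero fun z hz => h.bracket_H_L5 hz) (polynomialsIn_zero fun z hz => ?_)
      (polynomialsIn_congr g3 fun z hz => (h.bracket_L2_L5 hz).symm)
      (polynomialsIn_congr (polynomialsIn_const_mul (-16 * (p : 𝕜) ^ 2)
        (polynomialsIn_add (polynomialsIn_const_mul κ (polynomialsIn_pow g0 p))
          (polynomialsIn_mul g1 g2))) fun z hz => ?_)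
      (polynomialsIn_congr (polynomialsIn_add
        (polynomialsIn_const_mul (32 * (p : 𝕜) ^ 2) (polynomialsIn_evalEval g0 g1 G))
        (polynomialsIn_const_mul (8 * (p : 𝕜) ^ 2) (polynomialsIn_pow g2 2))) fun z hz => ?_) ?_
    · rw [poisson_const_mul _ (h.analytic_L4 z hz).differentiableAt, h.bracket_H_L4 z hz, mul_zero]
    · rw [poisson_const_mul _ (h.analytic_L4 z hz).differentiableAt, h.bracket_L2_L4 z hz,
        h.decomposition z hz]
      ring
    · rw [poisson_const_mul _ (h.analytic_L4 z hz).differentiableAt, hG z hz]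
      ring
    · rintro F (rfl | rfl | rfl)
      exacts [g0, g1, g2]
  intro F hF
  obtain ⟨Φ, hΦ⟩ := key F hF
  refine ⟨Φ, fun z hz => ?_⟩
  rw [hΦ z hz]
  congr 2
  funext i
  fin_cases i
  exacts [rfl, rfl, rfl, (h.bracket_L2_L5 hz).symm]

/-- L₃ is κH^p + L₂L₅ and L₄ is {L₂, L₅}/4p; p > 0 keeps H^p inside the algebra. -/
theorem symmetryAlgebra_subset_L5 (h : IsTTWSystem p q α β ω κ U H L2 L3 L4 L5) :
    symmetryAlgebra U {H, L2, L3, L4} ⊆ symmetryAlgebra U {H, L2, L5} := by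
  have g0 : InSymmetryAlgebra U {H, L2, L5} H := .generator (by simp)
  have g1 : InSymmetryAlgebra U {H, L2, L5} L2 := .generator (by simp)
  have g2 : InSymmetryAlgebra U {H, L2, L5} L5 := .generator (by simp)
  refine symmetryAlgebra_subset ?_
  rintro F (rfl | rfl | rfl | rfl)
  · exact g0
  · exact g1
  · obtain ⟨m, hm⟩ := Nat.exists_eq_add_of_lt h.pos
    rw [zero_add] at hm
    refine (((g0.pow_succ m).smul κ).sum (g1.prod g2)).congr fun z hz => ?_
    rw [h.decomposition z hz, hm]
  · refine ((g1.bracket g2).smul (4 * (p : 𝕜))⁻¹).congr fun z hz => ?_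
    have := h.four_mul_ne_zero
    simp only [h.bracket_L2_L5 hz]
    rw [← mul_assoc, inv_mul_cancel₀ this, one_mul]

/-- Reduction of a polynomial in four variables modulo a quadratic equation for the last one. -/
theorem exists_reduction (S : MvPolynomial (Fin 3) 𝕜) (c : 𝕜) (Φ : MvPolynomial (Fin 4) 𝕜) :
    ∃ Φ₀ Φ₁ : MvPolynomial (Fin 3) 𝕜, ∀ (v : Fin 3 → 𝕜) (x : 𝕜), x ^ 2 = S.eval v →
      Φ.eval ![v 0, v 1, v 2, c * x] = Φ₀.eval v + x * Φ₁.eval v := by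
  induction Φ using MvPolynomial.induction_on with
  | C a => exact ⟨MvPolynomial.C a, 0, fun v x _ => by simp⟩
  | add Φ Ψ hΦ hΨ =>
    obtain ⟨Φ₀, Φ₁, hΦ⟩ := hΦ
    obtain ⟨Ψ₀, Ψ₁, hΨ⟩ := hΨ
    refine ⟨Φ₀ + Ψ₀, Φ₁ + Ψ₁, fun v x hx => ?_⟩
    simp only [map_add, hΦ v x hx, hΨ v x hx]
    ring
  | mul_X Φ i hΦ =>
    obtain ⟨Φ₀, Φ₁, hΦ⟩ := hΦ
    have hX (j : Fin 3) : ∃ Ψ₀ Ψ₁ : MvPolynomial (Fin 3) 𝕜, ∀ (v : Fin 3 → 𝕜) (x : 𝕜),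
        x ^ 2 = S.eval v → Φ.eval ![v 0, v 1, v 2, c * x] * v j = Ψ₀.eval v + x * Ψ₁.eval v := by
      refine ⟨Φ₀ * MvPolynomial.X j, Φ₁ * MvPolynomial.X j, fun v x hx => ?_⟩
      simp only [map_mul, MvPolynomial.eval_X, hΦ v x hx]
      ring
    simp only [map_mul, MvPolynomial.eval_X]
    fin_cases i
    · exact hX 0
    · exact hX 1
    · exact hX 2
    -- Multiplying Φ₀ + xΦ₁ by cx and replacing x² by S exchanges the two components.
    · refine ⟨MvPolynomial.C c * S * Φ₁, MvPolynomial.C c * Φ₀, fun v x hx => ?_⟩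
      simp only [map_mul, MvPolynomial.eval_C, hΦ v x hx, ← hx, Fin.reduceFinMk,
        Matrix.cons_val]
      ring

/-- A polynomial of odd degree times a nonzero square is not a square. -/
theorem mul_sq_ne_sq_of_odd_natDegree {S u w : 𝕜[X]} (hS : Odd S.natDegree) (hu : u ≠ 0) :
    S * u ^ 2 ≠ w ^ 2 := by
  intro heq
  have hS0 : S ≠ 0 := by
    rintro rfl
    simp at hS
  have hdeg := congrArg natDegree heq
  rw [natDegree_mul hS0 (pow_ne_zero 2 hu), natDegree_pow, natDegree_pow] at hdeg
  obtain ⟨m, hm⟩ := hS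
  omega

theorem natDegree_ttwP_zero_le (p q : ℕ) (α β ω : 𝕜) :
    (4 * (((X - C α - C β) ^ 2 - 4 * C α * C β) ^ q *
      (0 ^ 2 - 4 * C ω ^ 2 * X) ^ p) : 𝕜[X]).natDegree ≤ 2 * q + p := by
  have h1 : ((X - C α - C β) ^ 2 - 4 * C α * C β : 𝕜[X]).natDegree ≤ 2 := by compute_degree
  have h2 : (0 ^ 2 - 4 * C ω ^ 2 * X : 𝕜[X]).natDegree ≤ 1 := by compute_degree
  have h4 : (4 : 𝕜[X]).natDegree ≤ 0 := by compute_degree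
  refine natDegree_mul_le.trans ?_
  refine (add_le_add h4 (natDegree_mul_le.trans (add_le_add
    (natDegree_pow_le_of_le q h1) (natDegree_pow_le_of_le p h2)))).trans ?_
  omega

/-- Membership would give L₅ = Φ₀ + L₃Φ₁ with Φ₀, Φ₁ polynomials in H, L₂, L₄. With L₃ = κH^p + L₂L₅
this becomes L₃(1 - L₂Φ₁) = κH^p + L₂Φ₀. Squaring removes L₃, and algebraic independence of H, L₂,
L₄ makes the result a polynomial identity, which degree parity refutes. -/
theorem L5_notMem (h : IsTTWSystem p q α β ω κ U H L2 L3 L4 L5) :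
    L5 ∉ symmetryAlgebra U {H, L2, L3, L4} := by
  intro hmem
  obtain ⟨Φ, hΦ⟩ := h.consistsOf_L4 L5 hmem
  let P : MvPolynomial (Fin 3) 𝕜 :=
    4 * (((MvPolynomial.X 1 - MvPolynomial.C α - MvPolynomial.C β) ^ 2 -
      4 * MvPolynomial.C α * MvPolynomial.C β) ^ q *
      (MvPolynomial.X 0 ^ 2 - 4 * MvPolynomial.C ω ^ 2 * MvPolynomial.X 1) ^ p)
  let S : MvPolynomial (Fin 3) 𝕜 := P - MvPolynomial.X 1 * MvPolynomial.X 2 ^ 2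
  obtain ⟨Φ₀, Φ₁, hred⟩ := exists_reduction S (-4 * (p : 𝕜)) Φ
  have hpoly : S * (1 - MvPolynomial.X 1 * Φ₁) ^ 2 =
      (MvPolynomial.C κ * MvPolynomial.X 0 ^ p + MvPolynomial.X 1 * Φ₀) ^ 2 := by
    refine eq_of_eval_eq_of_genericallyIndependent h.isOpen h.nonempty h.independent
      fun z hz => ?_
    have hS : L3 z ^ 2 = S.eval (fun i => (![H, L2, L4] : Fin 3 → _) i z) := by
      have := h.relation z hz
      simp only [ttwP] at this
      simp [S, P]
      linear_combination this
    have h5 := hΦ z hz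
    have hv : (fun i => (![H, L2, L4, fun z => -4 * (p : 𝕜) * L3 z] : Fin 4 → _) i z) =
        ![H z, L2 z, L4 z, -4 * (p : 𝕜) * L3 z] := by
      funext i
      fin_cases i <;> rfl
    rw [hv] at h5
    have hr := hred _ (L3 z) hS
    simp only [Matrix.cons_val] at hr
    rw [hr] at h5
    have hdec := h.decomposition z hz
    simp only [map_mul, map_pow, map_sub, map_add, map_one, MvPolynomial.eval_X,
      MvPolynomial.eval_C, ← hS, Matrix.cons_val]
    generalize MvPolynomial.eval (fun i => (![H, L2, L4] : Fin 3 → _) i z) Φ₀ = a at *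
    generalize MvPolynomial.eval (fun i => (![H, L2, L4] : Fin 3 → _) i z) Φ₁ = b at *
    have : L3 z * (1 - L2 z * b) = κ * H z ^ p + L2 z * a := by
      linear_combination hdec + L2 z * h5
    rw [← this]
    ring
  -- Setting H = 0, L₂ = X, L₄ = X^(p+q) gives L₂L₄² the odd degree 2(p + q) + 1. This exceeds the
  -- degree of 4P, which is at most 2q + p.
  have hsub := congrArg (MvPolynomial.aeval (![0, X, X ^ (p + q)] : Fin 3 → 𝕜[X])) hpoly
  rw [map_mul, map_pow, map_pow] at hsub
  refine mul_sq_ne_sq_of_odd_natDegree ?_ ?_ hsub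
  · have hS : MvPolynomial.aeval (![0, X, X ^ (p + q)] : Fin 3 → 𝕜[X]) S =
        4 * (((X - C α - C β) ^ 2 - 4 * C α * C β) ^ q * (0 ^ 2 - 4 * C ω ^ 2 * X) ^ p) -
          X ^ (2 * (p + q) + 1) := by
      simp only [S, P, map_sub, map_mul, map_pow, MvPolynomial.aeval_X, MvPolynomial.aeval_C,
        Polynomial.algebraMap_eq, map_ofNat, Matrix.cons_val]
      ring
    have hlt : (4 * (((X - C α - C β) ^ 2 - 4 * C α * C β) ^ q *
        (0 ^ 2 - 4 * C ω ^ 2 * X) ^ p) : 𝕜[X]).natDegree <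
        (X ^ (2 * (p + q) + 1) : 𝕜[X]).natDegree := by
      rw [natDegree_X_pow]
      exact (natDegree_ttwP_zero_le p q α β ω).trans_lt (by omega)
    rw [hS, natDegree_sub_eq_right_of_natDegree_lt hlt, natDegree_X_pow]
    exact ⟨p + q, rfl⟩
  -- The factor 1 - XΦ₁ takes the value 1 at X = 0, so it is not the zero polynomial.
  · intro h0
    have := congrArg (eval 0) h0
    simp at this

theorem symmetryAlgebra_ssubset (h : IsTTWSystem p q α β ω κ U H L2 L3 L4 L5) :
    symmetryAlgebra U {H, L2, L3, L4} ⊂ symmetryAlgebra U {H, L2, L5} :=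
  ⟨h.symmetryAlgebra_subset_L5, fun hsub => h.L5_notMem (hsub (.generator (by simp)))⟩

end IsTTWSystem

end Structure

/-! ### The functions L₃, L₄, L₅ and their relation to L⁺ and L⁻ -/

section Main

variable {𝕜 : Type*} [RCLike 𝕜] {k α β ω : 𝕜} {z : PhaseSpace 𝕜 2}

/-- The sign relating `A`, `B` to `L₃ / 2`, `L₄ / 2`. -/
def ttwSign (𝕜 : Type*) [RCLike 𝕜] (p q : ℕ) : 𝕜 := (-1) ^ ((p + q) / 2)

theorem ttwSign_sq (p q : ℕ) : ttwSign 𝕜 p q ^ 2 = 1 := by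
  rw [ttwSign, ← pow_mul, mul_comm, pow_mul, neg_one_sq, one_pow]

theorem ttwSign_ne_zero (p q : ℕ) : ttwSign 𝕜 p q ≠ 0 :=
  pow_ne_zero _ (neg_ne_zero.mpr one_ne_zero)

theorem toCx_ttwSign (p q : ℕ) : toCx (ttwSign 𝕜 p q) = (-1) ^ ((p + q) / 2) := by
  rw [ttwSign, toCx_pow, toCx_neg, toCx_one]

/-- Integer division rounds down, so the exponent is ⌊(p + q)/2⌋ - p. The factor (-1)^p is the one
that comes from (-H)^p. -/
theorem neg_one_zpow_half_sub (p q : ℕ) :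
    (-1 : 𝕜) ^ (((q : ℤ) - (p : ℤ)) / 2) = ttwSign 𝕜 p q * (-1) ^ p := by
  have h : ((q : ℤ) - (p : ℤ)) / 2 = ((p + q) / 2 : ℕ) - (p : ℤ) := by omega
  rw [h, zpow_sub₀ (neg_ne_zero.mpr one_ne_zero), zpow_natCast, zpow_natCast, ttwSign,
    div_eq_mul_inv, ← inv_pow, inv_neg, inv_one]

/-- `L₃`. -/
def ttwL3 (p q : ℕ) (k α β ω : 𝕜) (z : PhaseSpace 𝕜 2) : 𝕜 :=
  2 * ttwSign 𝕜 p q * (ttwProduct p q k α β ω).re z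

/-- `L₄`. -/
def ttwL4 (p q : ℕ) (k α β ω : 𝕜) (z : PhaseSpace 𝕜 2) : 𝕜 :=
  2 * ttwSign 𝕜 p q * (ttwProduct p q k α β ω).im z

/-- One factor i comes out of each of the q + p factors X and Y. -/
theorem ttwLplus_eq (p q : ℕ) {s : ℂ} (hs : s ^ 2 = toCx (ttwL2 k α β z)) :
    ttwLplus p q k α β ω s z =
      Complex.I ^ (p + q) * (ttwProduct p q k α β ω).value (-(Complex.I * s)) z := by
  have ht : (-(Complex.I * s)) ^ 2 = -toCx (ttwL2 k α β z) := by
    rw [neg_sq, mul_pow, Complex.I_sq, hs]; ring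
  have hX : ttwX k α β s Complex.I z =
      Complex.I * (ttwXElement k α β).value (-(Complex.I * s)) z := by
    simp only [ttwX, TTWAlgebra.value, ttwXElement, ttwXcoeff, ttwXfree]
    linear_combination s * toCx (sinK (2 * k * z.1 1) * z.2 1) * Complex.I_sq
  have hY : ttwY k α β ω s Complex.I z =
      Complex.I * (ttwYElement k α β ω).value (-(Complex.I * s)) z := by
    simp only [ttwY, TTWAlgebra.value, ttwYElement, ttwYcoeff, ttwYfree, toCx_mul (2 : 𝕜) (_ / _),
      toCx_two]
    linear_combination 2 * s * toCx (z.2 0 / z.1 0) * Complex.I_sq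
  rw [ttwLplus, ttwProduct, TTWAlgebra.value_mul ht, TTWAlgebra.value_pow ht,
    TTWAlgebra.value_pow ht, hX, hY]
  ring

theorem ttwLminus_eq (p q : ℕ) {s : ℂ} (hs : s ^ 2 = toCx (ttwL2 k α β z)) :
    ttwLminus p q k α β ω s z =
      (-Complex.I) ^ (p + q) * (ttwProduct p q k α β ω).value (Complex.I * s) z := by
  have ht : (Complex.I * s) ^ 2 = -toCx (ttwL2 k α β z) := by
    rw [mul_pow, Complex.I_sq, hs]; ring
  have hX : ttwX k α β s (-Complex.I) z =
      -Complex.I * (ttwXElement k α β).value (Complex.I * s) z := by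
    simp only [ttwX, TTWAlgebra.value, ttwXElement, ttwXcoeff, ttwXfree]
    linear_combination s * toCx (sinK (2 * k * z.1 1) * z.2 1) * Complex.I_sq
  have hY : ttwY k α β ω s (-Complex.I) z =
      -Complex.I * (ttwYElement k α β ω).value (Complex.I * s) z := by
    simp only [ttwY, TTWAlgebra.value, ttwYElement, ttwYcoeff, ttwYfree, toCx_mul (2 : 𝕜) (_ / _),
      toCx_two]
    linear_combination 2 * s * toCx (z.2 0 / z.1 0) * Complex.I_sq
  rw [ttwLminus, ttwProduct, TTWAlgebra.value_mul ht, TTWAlgebra.value_pow ht,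
    TTWAlgebra.value_pow ht, hX, hY]
  ring

theorem ttwLplus_mul_ttwLminus (p q : ℕ) (hz : z ∈ phaseOver (ttwDomain k)) {s : ℂ}
    (hs : s ^ 2 = toCx (ttwL2 k α β z)) :
    ttwLplus p q k α β ω s z * ttwLminus p q k α β ω s z =
      toCx (ttwP p q α β ω (ttwL2 k α β z) (ttwH k α β ω z)) := by
  rw [ttwLplus_eq p q hs, ttwLminus_eq p q hs, ← normAt_ttwProduct p q hz, TTWAlgebra.normAt,
    TTWAlgebra.value, TTWAlgebra.value, toCx_add, toCx_mul, toCx_pow, toCx_pow, ← hs]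
  have hI : Complex.I ^ (p + q) * (-Complex.I) ^ (p + q) = 1 := by
    rw [← mul_pow, mul_neg, Complex.I_mul_I, neg_neg, one_pow]
  generalize toCx ((ttwProduct p q k α β ω).re z) = A
  generalize toCx ((ttwProduct p q k α β ω).im z) = B
  linear_combination (A ^ 2 + s ^ 2 * B ^ 2) * hI -
    Complex.I ^ (p + q) * (-Complex.I) ^ (p + q) * s ^ 2 * B ^ 2 * Complex.I_sq

/-- For even p + q the powers of i and -i agree, so the sum of L⁺ and L⁻ isolates A. In the odd case
they are opposite and the difference does. -/
theorem toCx_ttwL3_ttwL4_of_even {p q : ℕ} (h : Even (p + q)) {s : ℂ} (hs0 : s ≠ 0)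
    (hs : s ^ 2 = toCx (ttwL2 k α β z)) :
    toCx (ttwL3 p q k α β ω z) = ttwLplus p q k α β ω s z + ttwLminus p q k α β ω s z ∧
    toCx (ttwL4 p q k α β ω z) =
      (ttwLminus p q k α β ω s z - ttwLplus p q k α β ω s z) / (Complex.I * s) := by
  obtain ⟨m, hm⟩ := h
  have hI : Complex.I ^ (p + q) = (-1) ^ m := by
    rw [hm, ← two_mul, pow_mul, Complex.I_sq]
  have hI' : (-Complex.I) ^ (p + q) = (-1) ^ m := by
    rw [hm, ← two_mul, pow_mul, neg_sq, Complex.I_sq]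
  rw [ttwLplus_eq p q hs, ttwLminus_eq p q hs, hI, hI', ttwL3, ttwL4, toCx_mul, toCx_mul,
    toCx_mul, toCx_mul, toCx_ttwSign, toCx_two, show (p + q) / 2 = m by omega]
  simp only [TTWAlgebra.value]
  have hIs : Complex.I * s ≠ 0 := mul_ne_zero Complex.I_ne_zero hs0
  refine ⟨by ring, ?_⟩
  rw [eq_div_iff hIs]
  ring

theorem toCx_ttwL3_ttwL4_of_odd {p q : ℕ} (h : Odd (p + q)) {s : ℂ} (hs0 : s ≠ 0)
    (hs : s ^ 2 = toCx (ttwL2 k α β z)) :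
    toCx (ttwL3 p q k α β ω z) =
      (ttwLplus p q k α β ω s z - ttwLminus p q k α β ω s z) / Complex.I ∧
    toCx (ttwL4 p q k α β ω z) =
      (ttwLplus p q k α β ω s z + ttwLminus p q k α β ω s z) / s := by
  obtain ⟨m, hm⟩ := h
  have hI : Complex.I ^ (p + q) = (-1) ^ m * Complex.I := by
    rw [hm, pow_succ, pow_mul, Complex.I_sq]
  have hI' : (-Complex.I) ^ (p + q) = -((-1) ^ m * Complex.I) := by
    rw [hm, pow_succ, pow_mul, neg_sq, Complex.I_sq]; ring
  rw [ttwLplus_eq p q hs, ttwLminus_eq p q hs, hI, hI', ttwL3, ttwL4, toCx_mul, toCx_mul,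
    toCx_mul, toCx_mul, toCx_ttwSign, toCx_two, show (p + q) / 2 = m by omega]
  simp only [TTWAlgebra.value]
  constructor
  · rw [eq_div_iff Complex.I_ne_zero]
    ring
  · rw [eq_div_iff hs0]
    linear_combination 2 * (-1) ^ m * s * toCx ((ttwProduct p q k α β ω).im z) * Complex.I_sq

theorem hasMomentumLead_ttwL3 {p q : ℕ} (hp : 0 < p) (hq : 0 < q) (hk : q * k = p) :
    HasMomentumLead (ttwDomain k) 1 (ttwL3 p q k α β ω) (2 * (p + q))
      (fun x => 2 * ttwSign 𝕜 p q * (-1) ^ q * (1 / x 0 ^ 2) ^ p * cosK (2 * p * x 1)) := by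
  have h := (hasLead_ttwProduct (α := α) (β := β) (ω := ω) hp hq hk).1.const_mul
    (2 * ttwSign 𝕜 p q)
  rw [show 2 * (p + q) - 2 + 2 = 2 * (p + q) by omega] at h
  exact h.congr (fun _ _ => rfl) (fun x _ => by ring)

theorem hasMomentumLead_ttwL4 {p q : ℕ} (hp : 0 < p) (hq : 0 < q) (hk : q * k = p) :
    HasMomentumLead (ttwDomain k) 1 (ttwL4 p q k α β ω) (2 * (p + q) - 1)
      (fun x => -(2 * ttwSign 𝕜 p q * (-1) ^ q) * (1 / x 0 ^ 2) ^ p * sinK (2 * p * x 1)) := by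
  have h := (hasLead_ttwProduct (α := α) (β := β) (ω := ω) hp hq hk).2.1.const_mul
    (2 * ttwSign 𝕜 p q)
  rw [show 2 * (p + q) - 2 + 1 = 2 * (p + q) - 1 by omega] at h
  exact h.congr (fun _ _ => rfl) (fun x _ => by ring)

/-- L₅ is the quotient of A - (α - β)^q (-H)^p by L₂ up to the factor ±2, so it is defined also
where L₂ = 0. -/
theorem exists_ttwL5 {p q : ℕ} (hp : 0 < p) (hq : 0 < q) (hk : q * k = p) :
    ∃ L5 : PhaseSpace 𝕜 2 → 𝕜,
      HasMomentumLead (ttwDomain k) 1 L5 (2 * (p + q) - 2)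
        (fun x => 2 * ttwSign 𝕜 p q * (-1) ^ q * (1 / x 0 ^ 2) ^ p * cosK (2 * p * x 1)) ∧
      ∀ z ∈ phaseOver (ttwDomain k), ttwL3 p q k α β ω z =
        2 * (-1 : 𝕜) ^ (((q : ℤ) - (p : ℤ)) / 2) * (α - β) ^ q * ttwH k α β ω z ^ p +
          ttwL2 k α β z * L5 z := by
  obtain ⟨-, -, -, C, hC, hK⟩ := hasLead_ttwProduct (α := α) (β := β) (ω := ω) hp hq hk
  refine ⟨fun z => 2 * ttwSign 𝕜 p q * C z,
    (hC.const_mul (2 * ttwSign 𝕜 p q)).congr (fun _ _ => rfl) (fun x _ => by ring), ?_⟩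
  intro z hz
  rw [ttwL3, hK z hz, neg_one_zpow_half_sub]
  simp only [neg_pow (ttwH k α β ω z)]
  ring

/-- Both claims follow from sin 4pθ = 2 sin 2pθ cos 2pθ: where the left side is nonzero, so are both
factors. -/
theorem subset_closure_lead_ne_zero {p : ℕ} (hp : 0 < p) (a : 𝕜) (ha : a ≠ 0)
    {D : Set (Fin 2 → 𝕜)} (hD : D = ttwDomain k) :
    (phaseOver D ⊆ closure {z | z ∈ phaseOver D ∧
      a * (1 / z.1 0 ^ 2) ^ p * cosK (2 * p * z.1 1) ≠ 0}) ∧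
    (phaseOver D ⊆ closure {z | z ∈ phaseOver D ∧
      a * (1 / z.1 0 ^ 2) ^ p * sinK (2 * p * z.1 1) ≠ 0}) := by
  subst hD
  have hc : (2 * (2 * p) : 𝕜) ≠ 0 := by
    have : (p : 𝕜) ≠ 0 := Nat.cast_ne_zero.mpr hp.ne'
    simpa using this
  have h := subset_closure_sinK_ne_zero (isOpen_ttwDomain k) hc
  constructor
  all_goals
    refine h.trans (closure_mono ?_)
    rintro z ⟨hz, hne⟩
    rw [mul_assoc, sinK_two_mul] at hne
    have h1 : (1 / z.1 0 ^ 2) ^ p ≠ 0 := pow_ne_zero _ (one_div_ne_zero (pow_ne_zero 2 hz.1))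
  · exact ⟨hz, mul_ne_zero (mul_ne_zero ha h1) (right_ne_zero_of_mul hne)⟩
  · exact ⟨hz, mul_ne_zero (mul_ne_zero ha h1)
      (right_ne_zero_of_mul (left_ne_zero_of_mul hne))⟩

theorem exists_lead_ne_zero {D : Set (Fin 2 → 𝕜)} (hne : D.Nonempty) {f : (Fin 2 → 𝕜) → 𝕜}
    (h : phaseOver D ⊆ closure {z | z ∈ phaseOver D ∧ f z.1 ≠ 0}) : ∃ x ∈ D, f x ≠ 0 := by
  obtain ⟨x, hx⟩ := hne
  have hU : (phaseOver D : Set (PhaseSpace 𝕜 2)).Nonempty := ⟨(x, 0), hx⟩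
  obtain ⟨z, hz, hfz⟩ := closure_nonempty_iff.mp (hU.mono h)
  exact ⟨z.1, hz, hfz⟩

end Main

end

theorem mainTheorem1 {𝕜 : Type*} [RCLike 𝕜] (p q : ℕ) (hp : 0 < p) (hq : 0 < q)
    (hpq : Nat.Coprime p q) (k : 𝕜) (hk : k = (p : 𝕜) / (q : 𝕜)) (α β ω : 𝕜)
    (D : Set (Fin 2 → 𝕜)) (hD : D = ttwDomain k)
    (U : Set (PhaseSpace 𝕜 2)) (hU : U = phaseOver D)
    (H L2 : PhaseSpace 𝕜 2 → 𝕜) (hH : H = ttwH k α β ω) (hL2 : L2 = ttwL2 k α β) :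
    ∃ L3 L4 L5 R : PhaseSpace 𝕜 2 → 𝕜,
      -- the definitions of L3 and L4, for either choice of the square root s of L2
      (∀ z ∈ U, ∀ s : ℂ, s ^ 2 = toCx (L2 z) → s ≠ 0 →
        (Even (p + q) →
          toCx (L3 z) = ttwLplus p q k α β ω s z + ttwLminus p q k α β ω s z ∧
          toCx (L4 z) =
            (ttwLminus p q k α β ω s z - ttwLplus p q k α β ω s z) / (Complex.I * s)) ∧
        (Odd (p + q) →
          toCx (L3 z) =
            (ttwLplus p q k α β ω s z - ttwLminus p q k α β ω s z) / Complex.I ∧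
          toCx (L4 z) = (ttwLplus p q k α β ω s z + ttwLminus p q k α β ω s z) / s)) ∧
      -- the product of L^+ and L^- is P(L2, H)
      (∀ z ∈ U, ∀ s : ℂ, s ^ 2 = toCx (L2 z) →
        ttwLplus p q k α β ω s z * ttwLminus p q k α β ω s z =
          toCx (ttwP p q α β ω (L2 z) (H z))) ∧
      -- constants of the motion, polynomial in the momenta
      (IsConstantOfMotion U H H ∧ HasMomentumOrder D H 2) ∧
      (IsConstantOfMotion U H L2 ∧ HasMomentumOrder D L2 2) ∧
      (IsConstantOfMotion U H L3 ∧ HasMomentumOrder D L3 (2 * (p + q))) ∧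
      (IsConstantOfMotion U H L4 ∧ HasMomentumOrder D L4 (2 * (p + q) - 1)) ∧
      (IsConstantOfMotion U H R ∧ IsPolynomialInMomenta D R) ∧
      -- functional independence and superintegrability
      GenericallyIndependent U ![H, L2, L3] ∧
      GenericallyIndependent U ![H, L2, L4] ∧
      IsMaximallySuperintegrable D H ∧
      -- the structure equations
      (∀ z ∈ U, poisson L2 L4 z = R z) ∧
      (∀ z ∈ U, R z = -4 * (p : 𝕜) * L3 z) ∧
      (∀ z ∈ U, poisson L2 L3 z = 4 * (p : 𝕜) * L2 z * L4 z) ∧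
      (∀ z ∈ U, poisson L2 R z = -16 * (p : 𝕜) ^ 2 * L2 z * L4 z) ∧
      (∀ z ∈ U, poisson L4 R z = 8 * (p : 𝕜) ^ 2 * L4 z ^ 2 -
        32 * (p : 𝕜) ^ 2 * deriv (fun l => ttwP p q α β ω l (H z)) (L2 z)) ∧
      (∀ z ∈ U, R z ^ 2 = -16 * (p : 𝕜) ^ 2 * L2 z * L4 z ^ 2 +
        64 * (p : 𝕜) ^ 2 * ttwP p q α β ω (L2 z) (H z)) ∧
      -- the algebra generated by H, L2, L3, L4 closes
      ConsistsOfPolynomialsIn U (symmetryAlgebra U {H, L2, L3, L4}) ![H, L2, L4, R] ∧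
      -- the generator L5, of order one less than the order of L4
      (∀ z ∈ U, L2 z ≠ 0 → L5 z =
        (L3 z - 2 * (-1 : 𝕜) ^ (((q : ℤ) - (p : ℤ)) / 2) * (α - β) ^ q * H z ^ p) / L2 z) ∧
      (IsConstantOfMotion U H L5 ∧ HasMomentumOrder D L5 (2 * (p + q) - 2)) ∧
      GenericallyIndependent U ![H, L2, L5] ∧
      ConsistsOfPolynomialsIn U (symmetryAlgebra U {H, L2, L5}) ![H, L2, L5, poisson L2 L5] ∧
      symmetryAlgebra U {H, L2, L3, L4} ⊂ symmetryAlgebra U {H, L2, L5} := by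

  subst hD hU hH hL2
  have hp0 : (p : 𝕜) ≠ 0 := Nat.cast_ne_zero.mpr hp.ne'
  have hq0 : (q : 𝕜) ≠ 0 := Nat.cast_ne_zero.mpr hq.ne'
  have hkq : (q : 𝕜) * k = p := by rw [hk, mul_div_cancel₀ _ hq0]
  have hk0 : k ≠ 0 := by rw [hk]; exact div_ne_zero hp0 hq0
  have hD := isOpen_ttwDomain k
  have hU := isOpen_phaseOver hD
  have hDne := ttwDomain_nonempty hk0
  have hUne : (phaseOver (ttwDomain k) : Set (PhaseSpace 𝕜 2)).Nonempty := by
    obtain ⟨x, hx⟩ := hDne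
    exact ⟨(x, 0), hx⟩
  have leadH := hasMomentumLead_ttwH k α β ω
  have leadL2 := hasMomentumLead_ttwL2 k α β
  have leadL3 := hasMomentumLead_ttwL3 (α := α) (β := β) (ω := ω) hp hq hkq
  have leadL4 := hasMomentumLead_ttwL4 (α := α) (β := β) (ω := ω) hp hq hkq
  obtain ⟨L5, leadL5, hL5⟩ := exists_ttwL5 (α := α) (β := β) (ω := ω) hp hq hkq
  have hsign : (2 * ttwSign 𝕜 p q * (-1) ^ q : 𝕜) ≠ 0 :=
    mul_ne_zero (mul_ne_zero two_ne_zero (ttwSign_ne_zero p q))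
      (pow_ne_zero _ (neg_ne_zero.mpr one_ne_zero))
  have dense3 := subset_closure_ne_zero_of_lead leadL3
    (subset_closure_lead_ne_zero hp _ hsign rfl).1
  have dense4 := subset_closure_ne_zero_of_lead leadL4
    (subset_closure_lead_ne_zero hp _ (neg_ne_zero.mpr hsign) rfl).2
  have dense2 : phaseOver (ttwDomain k) ⊆
      closure {z | z ∈ phaseOver (ttwDomain k) ∧ ttwL2 k α β z ≠ 0} :=
    subset_closure_ne_zero_of_lead leadL2 fun z hz => subset_closure ⟨hz, one_ne_zero⟩
  have aH := leadH.analyticOnNhd hD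
  have aL2 := leadL2.analyticOnNhd hD
  have aL3 := leadL3.analyticOnNhd hD
  have aL4 := leadL4.analyticOnNhd hD
  have aL5 := leadL5.analyticOnNhd hD
  have eigL2 {z : PhaseSpace 𝕜 2} (hz : z ∈ phaseOver (ttwDomain k)) :=
    isEigenvector_ttwProduct_ttwL2 (α := α) (β := β) (ω := ω) p q hz
  have eigH {z : PhaseSpace 𝕜 2} (hz : z ∈ phaseOver (ttwDomain k)) :=
    isEigenvector_ttwProduct_ttwH (α := α) (β := β) (ω := ω) p q hz hkq
  have bH3 : ∀ z ∈ phaseOver (ttwDomain k),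
      poisson (ttwH k α β ω) (ttwL3 p q k α β ω) z = 0 := fun z hz => by
    unfold ttwL3
    rw [poisson_const_mul _ (eigH hz).differentiable_re, (eigH hz).poisson_re]
    ring
  have bH4 : ∀ z ∈ phaseOver (ttwDomain k),
      poisson (ttwH k α β ω) (ttwL4 p q k α β ω) z = 0 := fun z hz => by
    unfold ttwL4
    rw [poisson_const_mul _ (eigH hz).differentiable_im, (eigH hz).poisson_im]
    ring
  have b23 : ∀ z ∈ phaseOver (ttwDomain k), poisson (ttwL2 k α β) (ttwL3 p q k α β ω) z =
      4 * p * ttwL2 k α β z * ttwL4 p q k α β ω z := fun z hz => by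
    unfold ttwL3 ttwL4
    rw [poisson_const_mul _ (eigL2 hz).differentiable_re, (eigL2 hz).poisson_re, hkq]
    ring
  have b24 : ∀ z ∈ phaseOver (ttwDomain k), poisson (ttwL2 k α β) (ttwL4 p q k α β ω) z =
      -4 * p * ttwL3 p q k α β ω z := fun z hz => by
    unfold ttwL3 ttwL4
    rw [poisson_const_mul _ (eigL2 hz).differentiable_im, (eigL2 hz).poisson_im, hkq]
    ring
  -- The bracket {L₂, L₃} = 4pL₂L₄ is generically nonzero because L₂ and L₄ are.
  have indep3 := genericallyIndependent_of_poisson (ω := ω) aL3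
    ((continuousOn_const.mul aL2.continuousOn).mul aL4.continuousOn) b23
    (subset_closure_mul_ne_zero hU (continuousOn_const.mul aL2.continuousOn)
      (subset_closure_mul_ne_zero hU continuousOn_const
        (fun z hz => subset_closure ⟨hz, by simpa using hp0⟩) dense2) dense4)
  have indep4 := genericallyIndependent_of_poisson (ω := ω) aL4
    (continuousOn_const.mul aL3.continuousOn) b24
    (subset_closure_mul_ne_zero hU continuousOn_const
      (fun z hz => subset_closure ⟨hz, by simpa using hp0⟩) dense3)
  have rel : ∀ z ∈ phaseOver (ttwDomain k), ttwL3 p q k α β ω z ^ 2 +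
      ttwL2 k α β z * ttwL4 p q k α β ω z ^ 2 =
      -- Four times the norm identity; the common sign of L₃ and L₄ squares to 1.
      4 * ttwP p q α β ω (ttwL2 k α β z) (ttwH k α β ω z) := fun z hz => by
    rw [← normAt_ttwProduct p q hz, TTWAlgebra.normAt, ttwL3, ttwL4]
    linear_combination 4 * ((ttwProduct p q k α β ω).re z ^ 2 +
      ttwL2 k α β z * (ttwProduct p q k α β ω).im z ^ 2) * ttwSign_sq (𝕜 := 𝕜) p q
  have sys : IsTTWSystem p q α β ω (2 * (-1 : 𝕜) ^ (((q : ℤ) - (p : ℤ)) / 2) * (α - β) ^ q)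
      (phaseOver (ttwDomain k)) (ttwH k α β ω) (ttwL2 k α β) (ttwL3 p q k α β ω)
      (ttwL4 p q k α β ω) L5 :=
    { pos := hp
      isOpen := hU
      nonempty := hUne
      analytic_H := aH
      analytic_L2 := aL2
      analytic_L3 := aL3
      analytic_L4 := aL4
      analytic_L5 := aL5
      bracket_H_L2 := fun z hz => poisson_ttwH_ttwL2 hz
      bracket_H_L3 := bH3
      bracket_H_L4 := bH4
      bracket_L2_L3 := b23
      bracket_L2_L4 := b24
      relation := rel
      decomposition := hL5
      sq_const := by
        have h1 : ((-1 : 𝕜) ^ p) ^ 2 = 1 := by rw [← pow_mul, mul_comm, pow_mul, neg_one_sq, one_pow]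
        rw [neg_one_zpow_half_sub, mul_pow, mul_pow, mul_pow, ttwSign_sq, h1]
        norm_num
      dense_L2 := dense2
      dense_L3 := dense3
      independent := indep4 }
  have indep5 := genericallyIndependent_of_poisson (ω := ω) aL5
    (continuousOn_const.mul aL4.continuousOn) (fun z hz => sys.bracket_L2_L5 hz)
    (subset_closure_mul_ne_zero hU continuousOn_const
      (fun z hz => subset_closure ⟨hz, by simpa using hp0⟩) dense4)
  have comH : IsConstantOfMotion (phaseOver (ttwDomain k)) (ttwH k α β ω) (ttwH k α β ω) :=
    ⟨aH, fun z _ => poisson_self _ z⟩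
  have comL2 : IsConstantOfMotion (phaseOver (ttwDomain k)) (ttwH k α β ω) (ttwL2 k α β) :=
    ⟨aL2, sys.bracket_H_L2⟩
  have leadR := leadL3.const_mul (-4 * (p : 𝕜))
  obtain ⟨x₀, hx₀⟩ := hDne
  have ordH := leadH.hasMomentumOrder ⟨x₀, hx₀, one_div_ne_zero (pow_ne_zero 2 hx₀.1)⟩
  have ordL2 := leadL2.hasMomentumOrder ⟨x₀, hx₀, one_ne_zero⟩
  have ordL3 := leadL3.hasMomentumOrder (exists_lead_ne_zero ⟨x₀, hx₀⟩
    (subset_closure_lead_ne_zero hp _ hsign rfl).1)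
  have ordL4 := leadL4.hasMomentumOrder (exists_lead_ne_zero ⟨x₀, hx₀⟩
    (subset_closure_lead_ne_zero hp _ (neg_ne_zero.mpr hsign) rfl).2)
  have ordL5 := leadL5.hasMomentumOrder (exists_lead_ne_zero ⟨x₀, hx₀⟩
    (subset_closure_lead_ne_zero hp _ hsign rfl).1)
  refine ⟨ttwL3 p q k α β ω, ttwL4 p q k α β ω, L5, fun z => -4 * (p : 𝕜) * ttwL3 p q k α β ω z,
    fun z _ s hs hs0 => ⟨fun h => toCx_ttwL3_ttwL4_of_even h hs0 hs,
      fun h => toCx_ttwL3_ttwL4_of_odd h hs0 hs⟩,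
    fun z hz s hs => ttwLplus_mul_ttwLminus p q hz hs,
    ⟨comH, ordH⟩, ⟨comL2, ordL2⟩, ⟨⟨aL3, bH3⟩, ordL3⟩, ⟨⟨aL4, bH4⟩, ordL4⟩,
    ⟨⟨leadR.analyticOnNhd hD, fun z hz => ?_⟩, leadR.isPolynomialInMomenta⟩,
    indep3, indep4, ⟨![ttwH k α β ω, ttwL2 k α β, ttwL3 p q k α β ω], fun i => ?_, indep3⟩,
    b24, fun z _ => rfl, b23, fun z hz => sys.bracket_L2_R hz, fun z hz => ?_, fun z hz => ?_,
    sys.consistsOf_L4, fun z hz h0 => ?_, ⟨⟨aL5, fun z hz => sys.bracket_H_L5 hz⟩, ordL5⟩,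
    indep5, sys.consistsOf_L5, sys.symmetryAlgebra_ssubset⟩
  · rw [poisson_const_mul _ (aL3 z hz).differentiableAt, bH3 z hz, mul_zero]
  -- The number 2n - 1 is 3 for n = 2 by computation.
  · change Fin 3 at i
    fin_cases i
    exacts [⟨comH, leadH.isPolynomialInMomenta⟩, ⟨comL2, leadL2.isPolynomialInMomenta⟩,
      ⟨⟨aL3, bH3⟩, leadL3.isPolynomialInMomenta⟩]
  · rw [IsTTWSystem.deriv_ttwP]
    exact sys.bracket_L4_R hz
  · linear_combination 16 * (p : 𝕜) ^ 2 * rel z hz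
  · rw [eq_div_iff h0, hL5 z hz]
    ring
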